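/- Let $d\ge 1$ and let $\mathcal R\subset\mathbb Z^d$ be a finite set (the admissible steps). Let $\mathcal G$ be the additive group generated by $\mathcal R$, let $\mathcal U\subset\mathbb R^d$ be the convex hull of $\mathcal R$, and let $\operatorname{ri}\mathcal U$ be its relative interior. Let $(\Omega,\mathfrak S,\mathbb P)$ be a probability space with measurable $\mathbb P$-preserving maps $T_x:\Omega\to\Omega$, $x\in\mathcal G$, such that $T_0=\mathrm{id}$ and $T_{x+y}=T_xT_y$, and assume ergodicity: every $A\in\mathfrak S$ with $T_z^{-1}A=A$ for all $z\in\mathcal R$ has $\mathbb P(A)\in\{0,1\}$. Let $\omega\mapsto(p_z(\omega))_{z\in\mathcal R}$ be a measurable map from $\Omega$ into the probability vectors on $\mathcal R$, with $p_z>0$ $\mathbb P$-almost surely for each $z\in\mathcal R$. For $\omega\in\Omega$ let $Q_0^\omega$ be the law on $(\mathbb Z^d)^{\mathbb Z_+}$ of the Markov chain $(X_n)_{n\ge0}$ with $X_0=0$ and transition probabilities $Q_0^\omega(X_{n+1}=y\mid X_n=x)=p_{y-x}(T_x\omega)$ if $y-x\in\mathcal R$, and $0$ otherwise. Assume that $g(\omega,z)=\log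 p_z(\omega)$ belongs to the class $\mathcal L$, that is, for each $\tilde z\in\mathcal R$, $g(\cdot,\tilde z)\in L^1(\mathbb P)$, and for every nonzero $z\in\mathcal R$ $$\varlimsup_{\varepsilon\searrow0}\ \varlimsup_{n\to\infty}\ \max_{x\in\mathcal G:\,|x|\le n}\ \frac1n\sum_{0\le k\le\varepsilon n}|g(T_{x+kz}\omega,\tilde z)|=0\qquad\text{for }\mathbb P\text{-a.e. }\omega .$$ For $\zeta\in\mathcal U$, an admissible sequence of lattice points is a sequence of the form $$\hat x_n(\zeta)=\sum_{z\in\mathcal R}\bigl(\lfloor n\beta_z\rfloor+b_z^{(n)}\bigr)z,\qquad n\in\mathbb Z_+,$$ where $\beta_z\in[0,1]$, $\sum_z\beta_z=1$, $\sum_z\beta_z z=\zeta$, all $\beta_z$ are rational if $\zeta\in\mathbb Q^d$, and $b_z^{(n)}\in\{0,1\}$ satisfy $b_z^{(n)}=0$ whenever $\beta_z=0$, and $\sum_z b_z^{(n)}=n-\sum_z\lfloor n\beta_z\rfloor$. Then there is a nonrandom, continuous, convex function $I:\mathcal U\to[0,\infty)$ such that: 1. For $\mathbb P$-a.e. $\omega$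 the distributions $Q_0^\omega\{X_n/n\in\cdot\,\}$ on $\mathcal U$ satisfy the large deviation principle with rate function $I$ at speed $n$: for every closed $F\subset\mathcal U$ and every relatively open $O\subset\mathcal U$, $$\varlimsup_{n\to\infty}\frac1n\log Q_0^\omega\{X_n/n\in F\}\le-\inf_{\zeta\in F}I(\zeta),\qquad \varliminf_{n\to\infty}\frac1n\log Q_0^\omega\{X_n/n\in O\}\ge-\inf_{\zeta\in O}I(\zeta).$$ 2. For $\mathbb P$-a.e. $\omega$, simultaneously for all $\zeta\in\operatorname{ri}\mathcal U$ and all admissible sequences $\hat x_n(\zeta)$, $$I(\zeta)=-\lim_{n\to\infty}\frac1n\log Q_0^\omega\{X_n=\hat x_n(\zeta)\}.$$ -/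

import Mathlib

open MeasureTheory ProbabilityTheory Filter Topology

noncomputable section

namespace RWRE

/-- The inclusion of the lattice `ℤ^d` into the Euclidean space `ℝ^d`. -/
def toE {d : ℕ} (x : Fin d → ℤ) : EuclideanSpace ℝ (Fin d) :=
  WithLp.toLp 2 (fun i => (x i : ℝ))

/-- The additive group generated by the finite set `R` of admissible steps. -/
abbrev stepGroup {d : ℕ} (R : Finset (Fin d → ℤ)) : AddSubgroup (Fin d → ℤ) :=
  AddSubgroup.closure (R : Set (Fin d → ℤ))

/-- An admissible step, as an element of the generated group. -/
def step {d : ℕ} {R : Finset (Fin d → ℤ)} (z : R) : stepGroup R :=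
  ⟨z, AddSubgroup.subset_closure z.2⟩

/-- The convex hull in `ℝ^d` of the set of admissible steps. -/
def hull {d : ℕ} (R : Finset (Fin d → ℤ)) : Set (EuclideanSpace ℝ (Fin d)) :=
  convexHull ℝ (toE '' (R : Set (Fin d → ℤ)))

/-- `(Ω, P, {T_x})` is an ergodic measurable dynamical system: `T` is an action on `Ω` of the group
generated by `R`, by measurable maps that preserve the probability measure `P`, and every event that
is invariant under all the steps `T_z`, `z ∈ R`, has probability zero or one. -/
structure IsErgodicSystem {d : ℕ} (R : Finset (Fin d → ℤ)) {Ω : Type*} [MeasurableSpace Ω]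
    (P : Measure Ω) (T : stepGroup R → Ω → Ω) : Prop where
  isProbabilityMeasure : IsProbabilityMeasure P
  map_zero : T 0 = id
  map_add : ∀ x y, T (x + y) = T x ∘ T y
  measurePreserving : ∀ x, MeasurePreserving (T x) P P
  zero_or_one : ∀ A : Set Ω, MeasurableSet A → (∀ z : R, T (step z) ⁻¹' A = A) → P A = 0 ∨ P A = 1

/-- The class `𝓛` of potentials `g : Ω × R^ℓ → ℝ`.  The iterated upper limit is taken in `[0, ∞]`;
the inner sum is over the integers `0 ≤ k ≤ ε n`. -/
def ClassL {d : ℕ} {R : Finset (Fin d → ℤ)} {Ω : Type*} [MeasurableSpace Ω] (P : Measure Ω)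
    (T : stepGroup R → Ω → Ω) (ℓ : ℕ) (g : Ω → (Fin ℓ → R) → ℝ) : Prop :=
  ∀ zt : Fin ℓ → R,
    MemLp (fun ω => g ω zt) 1 P ∧
    ∀ z : R, (z : Fin d → ℤ) ≠ 0 → ∀ᵐ ω ∂P,
      limsup (fun ε : ℝ =>
        limsup (fun n : ℕ =>
          ⨆ (x : stepGroup R) (_ : ‖toE (x : Fin d → ℤ)‖ ≤ (n : ℝ)),
            (∑ k ∈ Finset.range (⌊ε * n⌋₊ + 1), ‖g (T (x + k • step z) ω) zt‖ₑ) / (n : ENNReal))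
          atTop)
        (𝓝[>] (0 : ℝ)) = 0

/-- The one-step transition kernel of the walk in the environment `ω`: from `x` the walk jumps to
`x + z` with probability `p_z (T_x ω)`.  The walk started at `0` never leaves the group generated by
the admissible steps, so this group serves as state space. -/
def transition {d : ℕ} {R : Finset (Fin d → ℤ)} {Ω : Type*} (T : stepGroup R → Ω → Ω)
    (p : Ω → stdSimplex ℝ R) (ω : Ω) : Kernel (stepGroup R) (stepGroup R) :=
  Kernel.ofFunOfCountable fun x =>
    ∑ z : R, ENNReal.ofReal (p (T x ω) z) • Measure.dirac (x + step z)

instance {d : ℕ} {R : Finset (Fin d → ℤ)} {Ω : Type*} (T : stepGroup R → Ω → Ω)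
    (p : Ω → stdSimplex ℝ R) (ω : Ω) : IsMarkovKernel (transition T p ω) where
  isProbabilityMeasure x := by
    constructor
    have h := (p (T x ω)).2
    simp only [transition, Kernel.ofFunOfCountable, Kernel.coe_mk, Measure.finsetSum_apply,
      Measure.smul_apply, measure_univ, smul_eq_mul, mul_one]
    exact (ENNReal.ofReal_sum_of_nonneg (fun z _ => h.1 z)).symm.trans
      ((congrArg ENNReal.ofReal h.2).trans ENNReal.ofReal_one)

/-- The transition kernel as a function of the whole past `(x_0, …, x_n)`. -/
def pastKernel {d : ℕ} {R : Finset (Fin d → ℤ)} {Ω : Type*} (T : stepGroup R → Ω → Ω)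
    (p : Ω → stdSimplex ℝ R) (ω : Ω) (n : ℕ) :
    Kernel ((_ : Finset.Iic n) → stepGroup R) (stepGroup R) :=
  (transition T p ω).comap (fun h => h ⟨n, Finset.mem_Iic.2 le_rfl⟩) (measurable_pi_apply _)

instance {d : ℕ} {R : Finset (Fin d → ℤ)} {Ω : Type*} (T : stepGroup R → Ω → Ω)
    (p : Ω → stdSimplex ℝ R) (ω : Ω) (n : ℕ) : IsMarkovKernel (pastKernel T p ω n) := by
  unfold pastKernel; infer_instance

/-- The quenched path measure `Q_0^ω` on `(ℤ^d)^{ℤ_+}`: the law of the Markov chain started at `0`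
with the transition probabilities `p_{y-x}(T_x ω)`. -/
def quenched {d : ℕ} {R : Finset (Fin d → ℤ)} {Ω : Type*} (T : stepGroup R → Ω → Ω)
    (p : Ω → stdSimplex ℝ R) (ω : Ω) : Measure (ℕ → (Fin d → ℤ)) :=
  (Kernel.traj (X := fun _ => stepGroup R) (pastKernel T p ω) 0 (fun _ => 0)).map
    (fun X n => (X n : Fin d → ℤ))

/-- The law of `X_n / n` under `Q_0^ω`, as a measure on the convex hull of the steps. -/
def velocityLaw {d : ℕ} {R : Finset (Fin d → ℤ)} {Ω : Type*} (T : stepGroup R → Ω → Ω)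
    (p : Ω → stdSimplex ℝ R) (ω : Ω) (n : ℕ) : Measure (hull R) :=
  ((quenched T p ω).map (fun X => (n : ℝ)⁻¹ • toE (X n))).comap Subtype.val

/-- Large deviation principle with speed `n` for the sequence `μ` of measures, with rate function
`I`.  Logarithms and limits are taken in the extended real line. -/
structure SatisfiesLDP {S : Type*} [TopologicalSpace S] [MeasurableSpace S]
    (μ : ℕ → Measure S) (I : S → EReal) : Prop where
  nonneg : ∀ x, 0 ≤ I x
  lowerSemicontinuous : LowerSemicontinuous I
  upper : ∀ F : Set S, IsClosed F →
    limsup (fun n : ℕ => ENNReal.log (μ n F) / ((n : ℝ) : EReal)) atTop ≤ -(⨅ x ∈ F, I x)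
  lower : ∀ O : Set S, IsOpen O →
    -(⨅ x ∈ O, I x) ≤ liminf (fun n : ℕ => ENNReal.log (μ n O) / ((n : ℝ) : EReal)) atTop

/-- `xhat` is an admissible choice of the lattice points `x̂_n(ζ)`: for a convex representation
`ζ = ∑ β_z z` (with rational weights if `ζ` is rational),
`x̂_n(ζ) = ∑ (⌊n β_z⌋ + b_z^{(n)}) z` where `b_z^{(n)} ∈ {0, 1}`, `b_z^{(n)} = 0` if `β_z = 0`, and
`∑ b_z^{(n)} = n - ∑ ⌊n β_z⌋`. -/
def IsLatticeApprox {d : ℕ} (R : Finset (Fin d → ℤ)) (ζ : EuclideanSpace ℝ (Fin d))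
    (xhat : ℕ → (Fin d → ℤ)) : Prop :=
  ∃ (β : R → ℝ) (b : ℕ → R → ℤ),
    (∀ z, 0 ≤ β z) ∧ ∑ z, β z = 1 ∧ ∑ z : R, β z • toE (z : Fin d → ℤ) = ζ ∧
    ((∀ i, ∃ q : ℚ, ζ i = q) → ∀ z, ∃ q : ℚ, β z = q) ∧
    (∀ n z, b n z = 0 ∨ b n z = 1) ∧
    (∀ n z, β z = 0 → b n z = 0) ∧
    (∀ n : ℕ, ∑ z, b n z = n - ∑ z, ⌊(n : ℝ) * β z⌋) ∧
    (∀ n : ℕ, xhat n = ∑ z : R, (⌊(n : ℝ) * β z⌋ + b n z) • (z : Fin d → ℤ))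

end RWRE

end

/-!
Almost surely the walk satisfies a large deviation principle because minus the logarithm of the
probability of reaching a lattice point is a subadditive process.

A path is described by its *type* `a : R → ℕ`, which counts how often it uses each step.  The
endpoint of a path is determined by its type, and a path of `n` steps has one of at most
`(n + 1) ^ |R|` types.  The cost `pathCost a ω` of a type is minus the logarithm of the probability
to reach its endpoint in `∑ z, a z` steps.  By the Chapman–Kolmogorov inequality it is subadditive,
with a shift of the environment in the second term, and it is integrable because the logarithms of
the step probabilities are.

*Deterministic limits.*  For a type `a` with `1 ≤ a z` for all `z`, the costs of the multiples
`n • a`, divided by `n`, converge almost surely to the limit `costRate a` of their means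
(`ae_tendsto_pathCost`).  The shift along `a` need not be ergodic, but the asymptotic cost does not
increase when the environment is shifted by any single step, since the remaining steps of one copy
of `a` lead back to a multiple of `a`.  The zero-one law thus makes both asymptotic bounds
deterministic, and a covering argument of Katznelson and Weiss (`superadditive_integral_ge`)
compares them with the means.

*Extension.*  The function `costRate` is subadditive and homogeneous on integer vectors.  Its lower
semicontinuous extension to the closed orthant is continuous (`continuousOn_envelope`): upper
semicontinuity on the boundary uses that the orthant is polyhedral.  The values at two real frequency
vectors with the same mass and the same mean displacement agree, as the integer points of a rational
subspace lie within bounded distance of the multiples of any of its real vectors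
(`exists_int_kernel_approx`).  Hence there is a function on the hull of the steps, continuous since
the hull is a quotient of the simplex of frequencies, and convex since the extension is.

*Uniformity.*  The condition defining the class `𝓛` bounds the cost of detours of length `ε n`,
uniformly over starting points within distance of order `n` (`hasSmallDetours`).  By such detours,
an arbitrary type of `n` steps is compared with a multiple of one of finitely many positive types:
`eventually_le_pathCost` bounds the costs of all types below, and `eventually_pathCost_le` bounds
those of types with frequencies bounded away from zero above.  The upper bound of the large
deviation principle follows by counting types, and the lower bound by considering single endpoints
with positive frequencies.  An admissible sequence of lattice points of a point in the relative
interior consists of endpoints of types with asymptotically positive frequencies, even if the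
frequencies that define the sequence are not all positive.
-/

noncomputable section

namespace RWRE

/-! ### Ergodic theory -/

section ErgodicTheory

variable {Ω : Type*}

/-- The Katznelson–Weiss covering estimate along one orbit: if outside the set `B` one of the values
`φ 1, …, φ M` is nonnegative, the orbit can be cut into blocks on which `φ` is nonnegative, up to the
times at which it visits `B` and the last `M` times. -/
lemma superadditive_block_bound {τ : Ω → Ω} {φ : ℕ → Ω → ℝ} (h0 : ∀ ω, φ 0 ω = 0)
    (hsup : ∀ m n ω, φ m ω + φ n (τ^[m] ω) ≤ φ (m + n) ω) (M : ℕ) (B : Set Ω)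
    (hB : ∀ ω ∉ B, ∃ n, 1 ≤ n ∧ n ≤ M ∧ 0 ≤ φ n ω) (N : ℕ) (ω : Ω) :
    -(∑ i ∈ Finset.range N, B.indicator (fun ω => |φ 1 ω|) (τ^[i] ω))
      - ∑ i ∈ Finset.Ico (N - M) N, |φ 1 (τ^[i] ω)| ≤ φ N ω := by
  induction N using Nat.strong_induction_on generalizing ω with
  | _ N ih =>
  have hind : ∀ ω, 0 ≤ B.indicator (fun ω => |φ 1 ω|) ω :=
    fun ω => Set.indicator_nonneg (fun _ _ => abs_nonneg _) _
  -- the estimate at `τ^[n] ω` for the remaining time `N - n`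
  have key : ∀ n, 1 ≤ n → n ≤ N →
      -(∑ i ∈ Finset.Ico n N, B.indicator (fun ω => |φ 1 ω|) (τ^[i] ω))
      - ∑ i ∈ Finset.Ico (N - M) N, |φ 1 (τ^[i] ω)| ≤ φ (N - n) (τ^[n] ω) := by
    intro n hn hnN
    refine le_trans ?_ (ih (N - n) (by omega) (τ^[n] ω))
    have e1 : ∑ i ∈ Finset.range (N - n), B.indicator (fun ω => |φ 1 ω|) (τ^[i] (τ^[n] ω))
        = ∑ i ∈ Finset.Ico n N, B.indicator (fun ω => |φ 1 ω|) (τ^[i] ω) := by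
      rw [Finset.sum_Ico_eq_sum_range]
      refine Finset.sum_congr rfl fun i _ => ?_
      rw [← Function.iterate_add_apply, add_comm]
    have e2 : ∑ i ∈ Finset.Ico (N - n - M) (N - n), |φ 1 (τ^[i] (τ^[n] ω))|
        ≤ ∑ i ∈ Finset.Ico (N - M) N, |φ 1 (τ^[i] ω)| := by
      have : ∑ i ∈ Finset.Ico (N - n - M) (N - n), |φ 1 (τ^[i] (τ^[n] ω))|
          = ∑ i ∈ Finset.Ico (N - n - M + n) (N - n + n), |φ 1 (τ^[i] ω)| := by
        rw [← Finset.sum_Ico_add_right_sub_eq]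
        refine Finset.sum_congr rfl fun i hi => ?_
        simp only [Finset.mem_Ico] at hi
        rw [← Function.iterate_add_apply]
        congr 4
        omega
      rw [this]
      refine Finset.sum_le_sum_of_subset_of_nonneg ?_ fun _ _ _ => abs_nonneg _
      intro i hi
      simp only [Finset.mem_Ico] at hi ⊢
      omega
    rw [e1]
    linarith
  rcases Nat.eq_zero_or_pos N with rfl | hN
  · simp [h0]
  by_cases hω : ω ∈ B
  · have h1 := hsup 1 (N - 1) ω
    rw [Nat.add_sub_cancel' hN] at h1
    have h2 := key 1 le_rfl hN
    have h3 : ∑ i ∈ Finset.range N, B.indicator (fun ω => |φ 1 ω|) (τ^[i] ω)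
        = |φ 1 ω| + ∑ i ∈ Finset.Ico 1 N, B.indicator (fun ω => |φ 1 ω|) (τ^[i] ω) := by
      rw [Finset.range_eq_Ico, Finset.sum_eq_sum_Ico_succ_bot hN]
      simp [Set.indicator_of_mem hω]
    rw [h3]
    linarith [neg_abs_le (φ 1 ω)]
  · obtain ⟨n, hn1, hnM, hn⟩ := hB ω hω
    by_cases hnN : n ≤ N
    · have h1 := hsup n (N - n) ω
      rw [Nat.add_sub_cancel' hnN] at h1
      have h2 := key n hn1 hnN
      have h3 : ∑ i ∈ Finset.Ico n N, B.indicator (fun ω => |φ 1 ω|) (τ^[i] ω)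
          ≤ ∑ i ∈ Finset.range N, B.indicator (fun ω => |φ 1 ω|) (τ^[i] ω) := by
        refine Finset.sum_le_sum_of_subset_of_nonneg ?_ fun _ _ _ => hind _
        intro i hi
        simp only [Finset.mem_Ico, Finset.mem_range] at hi ⊢
        omega
      linarith
    · have h1 := hsup 1 (N - 1) ω
      rw [Nat.add_sub_cancel' hN] at h1
      have h2 : -(∑ i ∈ Finset.Ico 1 N, |φ 1 (τ^[i] ω)|) ≤ φ (N - 1) (τ^[1] ω) := by
        have : ∀ K ω, -(∑ i ∈ Finset.range K, |φ 1 (τ^[i] ω)|) ≤ φ K ω := by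
          intro K
          induction K with
          | zero => intro ω; simp [h0]
          | succ K ihK =>
            intro ω
            have := hsup K 1 ω
            rw [Finset.sum_range_succ]
            linarith [ihK ω, neg_abs_le (φ 1 (τ^[K] ω))]
        refine le_trans ?_ (this _ _)
        rw [Finset.sum_Ico_eq_sum_range]
        refine le_of_eq ?_
        congr 1
        refine Finset.sum_congr rfl fun i _ => ?_
        rw [← Function.iterate_add_apply, add_comm]
      have h3 : ∑ i ∈ Finset.Ico (N - M) N, |φ 1 (τ^[i] ω)|
          = |φ 1 ω| + ∑ i ∈ Finset.Ico 1 N, |φ 1 (τ^[i] ω)| := by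
        rw [show N - M = 0 by omega, Finset.sum_eq_sum_Ico_succ_bot hN]
        simp
      have h4 : 0 ≤ ∑ i ∈ Finset.range N, B.indicator (fun ω => |φ 1 ω|) (τ^[i] ω) :=
        Finset.sum_nonneg fun _ _ => hind _
      linarith [neg_abs_le (φ 1 ω)]

variable [MeasurableSpace Ω] {P : Measure Ω}

lemma integral_comp_iterate {τ : Ω → Ω} (hτ : MeasurePreserving τ P P) {f : Ω → ℝ}
    (hf : Measurable f) (i : ℕ) : ∫ ω, f (τ^[i] ω) ∂P = ∫ ω, f ω ∂P := by
  have h := (hτ.iterate i)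
  conv_rhs => rw [← h.map_eq]
  rw [integral_map h.measurable.aemeasurable hf.aestronglyMeasurable]

/-- A superadditive process that almost surely is nonnegative at some positive time has a
nonnegative mean growth rate. -/
theorem superadditive_integral_ge [IsProbabilityMeasure P] {τ : Ω → Ω}
    (hτ : MeasurePreserving τ P P) {φ : ℕ → Ω → ℝ}
    (hm : ∀ n, Measurable (φ n)) (hi : ∀ n, Integrable (φ n) P) (h0 : ∀ ω, φ 0 ω = 0)
    (hsup : ∀ m n ω, φ m ω + φ n (τ^[m] ω) ≤ φ (m + n) ω)
    (hret : ∀ᵐ ω ∂P, ∃ n, 1 ≤ n ∧ 0 ≤ φ n ω) {ε : ℝ} (hε : 0 < ε) :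
    ∀ᶠ N : ℕ in atTop, -(ε * N) ≤ ∫ ω, φ N ω ∂P := by
  let B : ℕ → Set Ω := fun M => {ω | ∀ n, 1 ≤ n → n ≤ M → φ n ω < 0}
  have hBm : ∀ M, MeasurableSet (B M) := by
    intro M
    simp only [B, Set.ofPred_forall]
    exact MeasurableSet.iInter fun n => MeasurableSet.iInter fun _ => MeasurableSet.iInter fun _ =>
      measurableSet_lt (hm n) measurable_const
  have hBanti : Antitone B := fun M M' h ω hω n h1 h2 => hω n h1 (h2.trans h)
  have hmψ : Measurable fun ω => |φ 1 ω| := (hm 1).abs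
  have hlim : Tendsto (fun M => ∫ ω in B M, |φ 1 ω| ∂P) atTop (𝓝 0) := by
    have h1 := tendsto_setIntegral_of_antitone (μ := P) (f := fun ω => |φ 1 ω|) hBm hBanti
      ⟨0, (hi 1).abs.integrableOn⟩
    have h2 : P (⋂ n, B n) = 0 := by
      refine measure_mono_null ?_ hret
      intro ω hω
      simp only [Set.mem_iInter] at hω
      change ¬ ∃ n, 1 ≤ n ∧ 0 ≤ φ n ω
      rintro ⟨n, h1, h2⟩
      exact absurd (hω n n h1 le_rfl) (not_lt.mpr h2)
    rwa [setIntegral_measure_zero _ h2] at h1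
  obtain ⟨M, hM⟩ := ((tendsto_order.1 hlim).2 (ε / 2) (by positivity)).exists
  have hN : ∀ᶠ N : ℕ in atTop, (M : ℝ) * ∫ ω, |φ 1 ω| ∂P ≤ ε / 2 * N :=
    (tendsto_natCast_atTop_atTop.const_mul_atTop (by positivity : 0 < ε / 2)).eventually_ge_atTop _
  filter_upwards [hN] with N hN
  have hindi : ∀ i, Integrable (fun ω => (B M).indicator (fun ω => |φ 1 ω|) (τ^[i] ω)) P :=
    fun i => (hτ.iterate i).integrable_comp_of_integrable ((hi 1).abs.indicator (hBm M))
  have hψi : ∀ i, Integrable (fun ω => |φ 1 (τ^[i] ω)|) P :=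
    fun i => (hτ.iterate i).integrable_comp_of_integrable (hi 1).abs
  have hneg : Integrable (fun ω =>
      -∑ i ∈ Finset.range N, (B M).indicator (fun ω => |φ 1 ω|) (τ^[i] ω)) P :=
    (integrable_finsetSum (Finset.range N) fun i _ => hindi i).neg
  have hb := integral_mono (μ := P)
    (hneg.sub (integrable_finsetSum (Finset.Ico (N - M) N) fun i _ => hψi i))
    (hi N)
    (superadditive_block_bound h0 hsup M (B M) (fun ω hω => by
      simp only [B, Set.mem_ofPred_eq, not_forall, not_lt] at hω
      obtain ⟨n, h1, h2, h3⟩ := hω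
      exact ⟨n, h1, h2, h3⟩) N)
  refine le_trans ?_ hb
  simp only [Pi.sub_apply]
  rw [integral_sub hneg
    (integrable_finsetSum (Finset.Ico (N - M) N) fun i _ => hψi i), integral_neg,
    integral_finsetSum _ (fun i _ => hindi i), integral_finsetSum _ (fun i _ => hψi i)]
  have e1 : ∀ i, ∫ ω, (B M).indicator (fun ω => |φ 1 ω|) (τ^[i] ω) ∂P = ∫ ω in B M, |φ 1 ω| ∂P := by
    intro i
    rw [integral_comp_iterate hτ (hmψ.indicator (hBm M)), integral_indicator (hBm M)]
  have e2 : ∀ i, ∫ ω, |φ 1 (τ^[i] ω)| ∂P = ∫ ω, |φ 1 ω| ∂P := fun i => integral_comp_iterate hτ hmψ i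
  simp only [e1, e2, Finset.sum_const, Finset.card_range, Nat.card_Ico, nsmul_eq_mul]
  have h3 : ((N - (N - M) : ℕ) : ℝ) * ∫ ω, |φ 1 ω| ∂P ≤ M * ∫ ω, |φ 1 ω| ∂P := by
    refine mul_le_mul_of_nonneg_right ?_ (integral_nonneg fun _ => abs_nonneg _)
    exact_mod_cast (by omega : N - (N - M) ≤ M)
  have h4 : (N : ℝ) * ∫ ω in B M, |φ 1 ω| ∂P ≤ N * (ε / 2) :=
    mul_le_mul_of_nonneg_left hM.le (Nat.cast_nonneg _)
  linarith

/-- An integrable function along an orbit grows sublinearly. -/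
theorem tendsto_orbit_div_atTop [IsProbabilityMeasure P] {h : Ω → ℝ} (hm : Measurable h)
    (hi : Integrable h P) (h0 : ∀ ω, 0 ≤ h ω) {τ : ℕ → Ω → Ω}
    (hτ : ∀ n, MeasurePreserving (τ n) P P) :
    ∀ᵐ ω ∂P, Tendsto (fun n : ℕ => h (τ n ω) / n) atTop (𝓝 0) := by
  have key : ∀ k : ℕ, ∀ᵐ ω ∂P, ∀ᶠ n : ℕ in atTop, h (τ n ω) ≤ n / (k + 1) := by
    intro k
    let X : Ω → ℝ := fun ω => (k + 1) * h ω
    have hsum : ∑' j : ℕ, P {ω | X ω ∈ Set.Ioi (j : ℝ)} < ⊤ := by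
      let _ : MeasureSpace Ω := ⟨P⟩
      have : IsProbabilityMeasure (volume : Measure Ω) := ‹IsProbabilityMeasure P›
      exact tsum_prob_mem_Ioi_lt_top (X := X) (hi.const_mul _)
        (fun ω => mul_nonneg (by positivity) (h0 ω))
    have hsum' : ∑' j : ℕ, P (τ j ⁻¹' {ω | X ω ∈ Set.Ioi (j : ℝ)}) ≠ ⊤ := by
      refine ne_of_lt (lt_of_eq_of_lt ?_ hsum)
      refine tsum_congr fun j => (hτ j).measure_preimage ?_
      exact ((hm.const_mul _) measurableSet_Ioi).nullMeasurableSet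
    filter_upwards [ae_eventually_notMem hsum'] with ω hω
    filter_upwards [hω] with n hn
    simp only [Set.mem_preimage, Set.mem_ofPred_eq, Set.mem_Ioi, not_lt, X] at hn
    rw [le_div_iff₀ (by positivity)]
    linarith
  filter_upwards [ae_all_iff.2 key] with ω hω
  rw [Metric.tendsto_atTop']
  intro ε hε
  obtain ⟨k, hk⟩ := exists_nat_one_div_lt hε
  obtain ⟨N, hN⟩ := eventually_atTop.1 (hω k)
  refine ⟨N, fun n hn => ?_⟩
  have hn' : (0 : ℝ) < n := by exact_mod_cast (by omega : 0 < n)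
  rw [Real.dist_eq, sub_zero, abs_of_nonneg (div_nonneg (h0 _) hn'.le), div_lt_iff₀ hn']
  calc h (τ n ω) ≤ n / (k + 1) := hN n hn.le
    _ = 1 / (k + 1) * n := by ring
    _ < ε * n := by gcongr

variable {G : Type*} [AddCommGroup G] {ι : Type*}

/-- A zero-one law for strictly invariant events extends to events that are almost surely
invariant in one direction, as such an event agrees almost surely with the intersection of its
translates. -/
theorem zero_or_one_of_ae_subinvariant [Countable G] [IsProbabilityMeasure P] {T : G → Ω → Ω}
    {s : ι → G} (hs : AddSubgroup.closure (Set.range s) = ⊤) (hT0 : ∀ ω, T 0 ω = ω)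
    (hTadd : ∀ x y ω, T (x + y) ω = T x (T y ω)) (hTmp : ∀ x, MeasurePreserving (T x) P P)
    (herg : ∀ A : Set Ω, MeasurableSet A → (∀ z, T (s z) ⁻¹' A = A) → P A = 0 ∨ P A = 1)
    {A : Set Ω} (hA : MeasurableSet A) (hinv : ∀ z, ∀ᵐ ω ∂P, T (s z) ω ∈ A → ω ∈ A) :
    P A = 0 ∨ P A = 1 := by
  have hx : ∀ x : G, T x ⁻¹' A =ᵐ[P] A := by
    intro x
    have hmem : x ∈ AddSubgroup.closure (Set.range s) := by rw [hs]; trivial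
    induction hmem using AddSubgroup.closure_induction with
    | mem x hx =>
      obtain ⟨z, rfl⟩ := hx
      refine ae_eq_of_ae_subset_of_measure_ge (hinv z) ?_
        ((hTmp _).measurable hA).nullMeasurableSet (measure_ne_top _ _)
      rw [(hTmp _).measure_preimage hA.nullMeasurableSet]
    | zero =>
      have : T 0 = id := funext hT0
      rw [this]; rfl
    | add x y _ _ hx hy =>
      have : T (x + y) ⁻¹' A = T y ⁻¹' (T x ⁻¹' A) := by
        ext ω; simp [hTadd]
      rw [this]
      exact ((hTmp y).quasiMeasurePreserving.preimage_ae_eq hx).trans hy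
    | neg x _ hx =>
      have h1 : T (-x) ⁻¹' (T x ⁻¹' A) = A := by
        ext ω; simp [← hTadd, hT0]
      have h2 := (hTmp (-x)).quasiMeasurePreserving.preimage_ae_eq hx
      rw [h1] at h2
      exact h2.symm
  have hA' : (⋂ x, T x ⁻¹' A) =ᵐ[P] A := by
    have h1 : (⋂ x : G, T x ⁻¹' A) =ᵐ[P] (⋂ _ : G, A) := Filter.EventuallyEq.countable_iInter hx
    rwa [Set.iInter_const] at h1
  rw [← measure_congr hA']
  refine herg _ (MeasurableSet.iInter fun x => (hTmp x).measurable hA) fun z => ?_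
  ext ω
  simp only [Set.mem_preimage, Set.mem_iInter, ← hTadd]
  constructor
  · intro h x
    have := h (x - s z)
    rwa [sub_add_cancel] at this
  · intro h x
    exact h _

end ErgodicTheory

/-! ### Transition probabilities and the cost of a type -/

section Walk

/-- Induction over types, one step at a time. -/
lemma type_induction {ι : Type*} [Fintype ι] [DecidableEq ι] {motive : (ι → ℕ) → Prop} (zero : motive 0)
    (add : ∀ a z, motive a → motive (a + Pi.single z 1)) (a : ι → ℕ) : motive a := by
  generalize hn : ∑ z, a z = n
  induction n generalizing a with
  | zero =>
    have : a = 0 := by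
      funext z
      exact (Finset.sum_eq_zero_iff.1 hn) z (Finset.mem_univ z)
    rwa [this]
  | succ n ih =>
    obtain ⟨z, hz⟩ : ∃ z, a z ≠ 0 := by
      by_contra h
      push Not at h
      simp [h] at hn
    have hle : Pi.single z 1 ≤ a := by
      intro w
      by_cases h : w = z
      · subst h; simp; omega
      · simp [h]
    have ha : a - Pi.single z 1 + Pi.single z 1 = a := tsub_add_cancel_of_le hle
    rw [← ha]
    refine add _ _ (ih _ ?_)
    have h2 : ∑ w, (a - Pi.single z 1 + Pi.single z 1 : ι → ℕ) w = n + 1 := by rw [ha, hn]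
    simp only [Pi.add_apply, Finset.sum_add_distrib] at h2
    have h3 : ∑ w, (Pi.single z 1 : ι → ℕ) w = 1 := by simp
    omega

variable {G : Type*} [AddCommGroup G] {ι : Type*} [Fintype ι] {Ω : Type*}

open Classical in
/-- The probability that the walk in the environment `ω`, started at `0`, is at `x` after `n` steps.
The recursion conditions on the first step, after which the walk sees the shifted environment. -/
def stepProb (T : G → Ω → Ω) (s : ι → G) (p : Ω → ι → ℝ) : ℕ → Ω → G → ℝ
  | 0, _, x => if x = 0 then 1 else 0
  | n + 1, ω, x => ∑ z, p ω z * stepProb T s p n (T (s z) ω) (x - s z)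

/-- The endpoint of a path of type `a`, that is, of a path with `a z` steps `s z` for each `z`. -/
def endpoint (s : ι → G) (a : ι → ℕ) : G := ∑ z, a z • s z

/-- The cost of the type `a` in the environment `ω`: minus the logarithm of the probability that the
walk reaches, in as many steps as `a` has, the endpoint of `a`.  The cost depends on the type only
through its number of steps and its endpoint. -/
def pathCost (T : G → Ω → Ω) (s : ι → G) (p : Ω → ι → ℝ) (a : ι → ℕ) (ω : Ω) : ℝ :=
  -Real.log (stepProb T s p (∑ z, a z) ω (endpoint s a))

/-- The group action and the positive probability vectors that drive the walk. -/
structure IsWalk (T : G → Ω → Ω) (p : Ω → ι → ℝ) : Prop where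
  map_zero : ∀ ω, T 0 ω = ω
  map_add : ∀ x y ω, T (x + y) ω = T x (T y ω)
  pos : ∀ ω z, 0 < p ω z
  sum_eq_one : ∀ ω, ∑ z, p ω z = 1

lemma endpoint_add (s : ι → G) (a b : ι → ℕ) :
    endpoint s (a + b) = endpoint s a + endpoint s b := by
  simp [endpoint, add_smul, Finset.sum_add_distrib]

@[simp] lemma endpoint_zero (s : ι → G) : endpoint s 0 = 0 := by simp [endpoint]

lemma endpoint_single (s : ι → G) (z : ι) (k : ℕ) [DecidableEq ι] :
    endpoint s (Pi.single z k) = k • s z := by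
  rw [endpoint, Finset.sum_eq_single z]
  · simp
  · intro w _ hw; simp [hw]
  · simp

lemma endpoint_nsmul (s : ι → G) (n : ℕ) (a : ι → ℕ) :
    endpoint s (n • a) = n • endpoint s a := by
  simp [endpoint, Finset.smul_sum, mul_smul]

variable {T : G → Ω → Ω} {s : ι → G} {p : Ω → ι → ℝ}

namespace IsWalk

lemma stepProb_nonneg (h : IsWalk T p) (n : ℕ) (ω : Ω) (x : G) : 0 ≤ stepProb T s p n ω x := by
  induction n generalizing ω x with
  | zero => simp only [stepProb]; split_ifs <;> norm_num
  | succ n ih => exact Finset.sum_nonneg fun z _ => mul_nonneg (h.pos _ _).le (ih _ _)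

lemma stepProb_le_one (h : IsWalk T p) (n : ℕ) (ω : Ω) (x : G) : stepProb T s p n ω x ≤ 1 := by
  induction n generalizing ω x with
  | zero => simp only [stepProb]; split_ifs <;> norm_num
  | succ n ih =>
    rw [← h.sum_eq_one ω]
    exact Finset.sum_le_sum fun z _ => mul_le_of_le_one_right (h.pos _ _).le (ih _ _)

lemma iterate_eq (h : IsWalk T p) (x : G) (n : ℕ) (ω : Ω) : (T x)^[n] ω = T (n • x) ω := by
  induction n generalizing ω with
  | zero => simp [h.map_zero]
  | succ n ih => rw [Function.iterate_succ_apply, ih, ← h.map_add, succ_nsmul]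

/-- The Chapman–Kolmogorov inequality. -/
lemma stepProb_mul_le (h : IsWalk T p) (m n : ℕ) (ω : Ω) (x y : G) :
    stepProb T s p m ω x * stepProb T s p n (T x ω) y ≤ stepProb T s p (m + n) ω (x + y) := by
  induction m generalizing ω x with
  | zero =>
    by_cases hx : x = 0
    · subst hx; simp [stepProb, h.map_zero]
    · simp only [stepProb, hx, if_false, zero_mul]
      exact h.stepProb_nonneg _ _ _
  | succ m ih =>
    rw [add_right_comm, stepProb, stepProb, Finset.sum_mul]
    refine Finset.sum_le_sum fun z _ => ?_
    rw [mul_assoc]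
    refine mul_le_mul_of_nonneg_left ?_ (h.pos _ _).le
    have := ih (T (s z) ω) (x - s z)
    rw [← h.map_add, sub_add_cancel, sub_add_eq_add_sub] at this
    exact this

/-- The recursion that conditions on the last step. -/
lemma stepProb_succ_last (h : IsWalk T p) (n : ℕ) (ω : Ω) (x : G) :
    stepProb T s p (n + 1) ω x = ∑ z, stepProb T s p n ω (x - s z) * p (T (x - s z) ω) z := by
  induction n generalizing ω x with
  | zero =>
    simp only [stepProb]
    refine Finset.sum_congr rfl fun z _ => ?_
    by_cases hx : x - s z = 0
    · simp [hx, h.map_zero]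
    · simp [hx]
  | succ n ih =>
    rw [stepProb]
    conv_lhs => simp only [ih]
    conv_rhs => simp only [stepProb]
    simp only [Finset.mul_sum, Finset.sum_mul]
    rw [Finset.sum_comm]
    refine Finset.sum_congr rfl fun z _ => Finset.sum_congr rfl fun w _ => ?_
    rw [← h.map_add, sub_right_comm x (s w) (s z), sub_add_cancel, mul_assoc]

lemma le_stepProb_one (h : IsWalk T p) (ω : Ω) (z : ι) : p ω z ≤ stepProb T s p 1 ω (s z) := by
  have h1 : p ω z * stepProb T s p 0 (T (s z) ω) (s z - s z) = p ω z := by simp [stepProb]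
  rw [← h1]
  exact Finset.single_le_sum (f := fun w => p ω w * stepProb T s p 0 (T (s w) ω) (s z - s w))
    (fun w _ => mul_nonneg (h.pos _ _).le (h.stepProb_nonneg _ _ _)) (Finset.mem_univ z)

lemma stepProb_endpoint_pos (h : IsWalk T p) (a : ι → ℕ) (ω : Ω) :
    0 < stepProb T s p (∑ z, a z) ω (endpoint s a) := by
  classical
  induction a using type_induction with
  | zero => simp [stepProb]
  | add a z ih =>
    have h1 := h.stepProb_mul_le (s := s) (∑ z, a z) 1 ω (endpoint s a) (s z)
    have h2 := h.le_stepProb_one (s := s) (T (endpoint s a) ω) z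
    have h3 : ∑ w, (a + Pi.single z 1 : ι → ℕ) w = ∑ w, a w + 1 := by simp [Finset.sum_add_distrib]
    rw [h3, endpoint_add, endpoint_single, one_smul]
    exact lt_of_lt_of_le (mul_pos ih ((h.pos _ _).trans_le h2)) h1

lemma exp_neg_pathCost (h : IsWalk T p) (a : ι → ℕ) (ω : Ω) :
    Real.exp (-pathCost T s p a ω) = stepProb T s p (∑ z, a z) ω (endpoint s a) := by
  rw [pathCost, neg_neg, Real.exp_log (h.stepProb_endpoint_pos a ω)]

lemma pathCost_nonneg (h : IsWalk T p) (a : ι → ℕ) (ω : Ω) : 0 ≤ pathCost T s p a ω := by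
  rw [pathCost, neg_nonneg]
  exact Real.log_nonpos (h.stepProb_nonneg _ _ _) (h.stepProb_le_one _ _ _)

lemma pathCost_zero (ω : Ω) : pathCost T s p 0 ω = 0 := by
  simp [pathCost, stepProb]

lemma pathCost_add_le (h : IsWalk T p) (a b : ι → ℕ) (ω : Ω) :
    pathCost T s p (a + b) ω ≤ pathCost T s p a ω + pathCost T s p b (T (endpoint s a) ω) := by
  have h1 := h.stepProb_mul_le (s := s) (∑ z, a z) (∑ z, b z) ω (endpoint s a) (endpoint s b)
  have h2 := h.stepProb_endpoint_pos (s := s) a ω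
  have h3 := h.stepProb_endpoint_pos (s := s) b (T (endpoint s a) ω)
  have h4 : ∑ z, (a + b) z = ∑ z, a z + ∑ z, b z := by simp [Finset.sum_add_distrib]
  simp only [pathCost]
  rw [h4, endpoint_add, ← neg_add, ← Real.log_mul h2.ne' h3.ne', neg_le_neg_iff]
  exact Real.log_le_log (mul_pos h2 h3) h1

lemma pathCost_single_le [DecidableEq ι] (h : IsWalk T p) (z : ι) (ω : Ω) :
    pathCost T s p (Pi.single z 1) ω ≤ |Real.log (p ω z)| := by
  have h1 : ∑ w, (Pi.single z 1 : ι → ℕ) w = 1 := by simp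
  rw [pathCost, h1, endpoint_single, one_smul]
  have := Real.log_le_log (h.pos ω z) (h.le_stepProb_one (s := s) ω z)
  linarith [neg_abs_le (Real.log (p ω z))]

lemma pathCost_congr {a b : ι → ℕ}
    (h1 : ∑ z, a z = ∑ z, b z) (h2 : endpoint s a = endpoint s b) :
    pathCost T s p a = pathCost T s p b := by
  funext ω
  rw [pathCost, pathCost, h1, h2]

/-- Along a multiple of a type the cost is at most the sum of the costs of its repetitions. -/
lemma pathCost_nsmul_le (h : IsWalk T p) (a : ι → ℕ) (n : ℕ) (ω : Ω) :
    pathCost T s p (n • a) ω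
      ≤ ∑ i ∈ Finset.range n, pathCost T s p a (T (i • endpoint s a) ω) := by
  induction n with
  | zero => simp [pathCost_zero]
  | succ n ih =>
    rw [succ_nsmul, Finset.sum_range_succ, ← endpoint_nsmul]
    exact (h.pathCost_add_le _ _ _).trans (by gcongr)

end IsWalk

variable [MeasurableSpace Ω]

/-- A walk in an ergodic environment whose step probabilities have integrable logarithms. -/
structure IsErgodicWalk (P : Measure Ω) (T : G → Ω → Ω) (s : ι → G) (p : Ω → ι → ℝ) : Prop
    extends IsWalk T p where
  closure_eq_top : AddSubgroup.closure (Set.range s) = ⊤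
  measurePreserving : ∀ x, MeasurePreserving (T x) P P
  zero_or_one : ∀ A : Set Ω, MeasurableSet A → (∀ z, T (s z) ⁻¹' A = A) → P A = 0 ∨ P A = 1
  measurable_prob : ∀ z, Measurable fun ω => p ω z
  integrable_log : ∀ z, Integrable (fun ω => Real.log (p ω z)) P

/-- The mean cost of a type. -/
def meanCost (P : Measure Ω) (T : G → Ω → Ω) (s : ι → G) (p : Ω → ι → ℝ) (a : ι → ℕ) : ℝ :=
  ∫ ω, pathCost T s p a ω ∂P

/-- A bound for the mean cost of one step. -/
def costBound (P : Measure Ω) (p : Ω → ι → ℝ) : ℝ := ∑ z, ∫ ω, |Real.log (p ω z)| ∂P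

/-- The asymptotic mean cost per repetition of the type `a`.  As the mean costs of the multiples of
`a` are subadditive, the infimum is a limit. -/
def costRate (P : Measure Ω) (T : G → Ω → Ω) (s : ι → G) (p : Ω → ι → ℝ) (a : ι → ℕ) : ℝ :=
  sInf ((fun n : ℕ => meanCost P T s p (n • a) / n) '' Set.Ici 1)

namespace IsErgodicWalk

variable {P : Measure Ω}

lemma measurable_stepProb (h : IsErgodicWalk P T s p) (n : ℕ) (x : G) :
    Measurable fun ω => stepProb T s p n ω x := by
  induction n generalizing x with
  | zero => simp only [stepProb]; exact measurable_const
  | succ n ih =>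
    simp only [stepProb]
    refine Finset.measurable_fun_sum _ fun z _ => (h.measurable_prob z).mul ?_
    exact (ih _).comp (h.measurePreserving _).measurable

lemma measurable_pathCost (h : IsErgodicWalk P T s p) (a : ι → ℕ) :
    Measurable (pathCost T s p a) :=
  (Real.measurable_log.comp (h.measurable_stepProb _ _)).neg

lemma integral_comp (h : IsErgodicWalk P T s p) {f : Ω → ℝ} (hf : Measurable f) (x : G) :
    ∫ ω, f (T x ω) ∂P = ∫ ω, f ω ∂P :=
  integral_comp_iterate (h.measurePreserving x) hf 1

lemma integrable_and_meanCost_le (h : IsErgodicWalk P T s p) (a : ι → ℕ) :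
    Integrable (pathCost T s p a) P ∧ meanCost P T s p a ≤ costBound P p * ∑ z, (a z : ℝ) := by
  classical
  induction a using type_induction with
  | zero =>
    have : pathCost T s p 0 = fun _ => 0 := funext fun ω => IsWalk.pathCost_zero ω
    simp [this, meanCost]
  | add a z ih =>
    have hle : ∀ ω, pathCost T s p (a + Pi.single z 1) ω
        ≤ pathCost T s p a ω + |Real.log (p (T (endpoint s a) ω) z)| := fun ω =>
      (h.pathCost_add_le a _ ω).trans (by gcongr; exact h.pathCost_single_le z _)
    have hmlog : Measurable fun ω => |Real.log (p ω z)| :=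
      (Real.measurable_log.comp (h.measurable_prob z)).abs
    have hil : Integrable (fun ω => |Real.log (p (T (endpoint s a) ω) z)|) P :=
      (h.measurePreserving _).integrable_comp_of_integrable
        (g := fun ω => |Real.log (p ω z)|) (h.integrable_log z).abs
    have hi : Integrable (pathCost T s p (a + Pi.single z 1)) P := by
      refine (ih.1.add hil).mono' (h.measurable_pathCost _).aestronglyMeasurable ?_
      filter_upwards with ω
      rw [Real.norm_eq_abs, abs_of_nonneg (h.pathCost_nonneg _ _)]
      exact hle ω
    refine ⟨hi, ?_⟩
    have h1 : meanCost P T s p (a + Pi.single z 1)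
        ≤ meanCost P T s p a + ∫ ω, |Real.log (p ω z)| ∂P := by
      have := integral_mono hi (ih.1.add hil) hle
      simp only [Pi.add_apply] at this
      rw [integral_add ih.1 hil, h.integral_comp hmlog] at this
      exact this
    have h2 : ∫ ω, |Real.log (p ω z)| ∂P ≤ costBound P p :=
      Finset.single_le_sum (f := fun z => ∫ ω, |Real.log (p ω z)| ∂P)
        (fun _ _ => integral_nonneg fun _ => abs_nonneg _) (Finset.mem_univ z)
    have h3 : ∑ w, (((a + Pi.single z 1 : ι → ℕ) w : ℕ) : ℝ) = ∑ w, (a w : ℝ) + 1 := by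
      have : ∑ w, (a + Pi.single z 1 : ι → ℕ) w = ∑ w, a w + 1 := by simp [Finset.sum_add_distrib]
      exact_mod_cast this
    rw [h3]
    linarith [ih.2]

lemma integrable_pathCost (h : IsErgodicWalk P T s p) (a : ι → ℕ) :
    Integrable (pathCost T s p a) P := (h.integrable_and_meanCost_le a).1

lemma meanCost_nonneg (h : IsErgodicWalk P T s p) (a : ι → ℕ) : 0 ≤ meanCost P T s p a :=
  integral_nonneg fun ω => h.pathCost_nonneg a ω

lemma meanCost_add_le (h : IsErgodicWalk P T s p) (a b : ι → ℕ) :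
    meanCost P T s p (a + b) ≤ meanCost P T s p a + meanCost P T s p b := by
  have hib : Integrable (fun ω => pathCost T s p b (T (endpoint s a) ω)) P :=
    (h.measurePreserving _).integrable_comp_of_integrable (h.integrable_pathCost b)
  have := integral_mono (h.integrable_pathCost (a + b)) ((h.integrable_pathCost a).add hib)
    (fun ω => h.pathCost_add_le a b ω)
  simp only [Pi.add_apply] at this
  rw [integral_add (h.integrable_pathCost a) hib, h.integral_comp (h.measurable_pathCost b)] at this
  exact this

lemma subadditive_meanCost (h : IsErgodicWalk P T s p) (a : ι → ℕ) :
    Subadditive fun n : ℕ => meanCost P T s p (n • a) := fun m n => by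
  simp only [add_smul]; exact h.meanCost_add_le _ _

lemma bddBelow_meanCost (h : IsErgodicWalk P T s p) (a : ι → ℕ) :
    BddBelow (Set.range fun n : ℕ => meanCost P T s p (n • a) / n) :=
  ⟨0, by rintro _ ⟨n, rfl⟩; exact div_nonneg (h.meanCost_nonneg _) (Nat.cast_nonneg _)⟩

lemma lim_eq (h : IsErgodicWalk P T s p) (a : ι → ℕ) :
    (h.subadditive_meanCost a).lim = costRate P T s p a := by
  rw [Subadditive.lim, costRate]

lemma tendsto_meanCost (h : IsErgodicWalk P T s p) (a : ι → ℕ) :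
    Tendsto (fun n : ℕ => meanCost P T s p (n • a) / n) atTop (𝓝 (costRate P T s p a)) := by
  rw [← h.lim_eq]
  exact   (h.subadditive_meanCost a).tendsto_lim (h.bddBelow_meanCost a)

lemma costRate_nonneg (h : IsErgodicWalk P T s p) (a : ι → ℕ) : 0 ≤ costRate P T s p a :=
  ge_of_tendsto' (h.tendsto_meanCost a)
    fun _ => div_nonneg (h.meanCost_nonneg _) (Nat.cast_nonneg _)

lemma costRate_mul_le (h : IsErgodicWalk P T s p) (a : ι → ℕ) (n : ℕ) :
    costRate P T s p a * n ≤ meanCost P T s p (n • a) := by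
  rcases Nat.eq_zero_or_pos n with rfl | hn
  · simpa using h.meanCost_nonneg _
  · rw [← le_div_iff₀ (by exact_mod_cast hn)]
    rw [← h.lim_eq]
    exact (h.subadditive_meanCost a).lim_le_div (h.bddBelow_meanCost a) hn.ne'

lemma costRate_add_le (h : IsErgodicWalk P T s p) (a b : ι → ℕ) :
    costRate P T s p (a + b) ≤ costRate P T s p a + costRate P T s p b := by
  refine le_of_tendsto_of_tendsto' (h.tendsto_meanCost (a + b))
    ((h.tendsto_meanCost a).add (h.tendsto_meanCost b)) fun n => ?_
  rw [← add_div, smul_add]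
  gcongr
  exact h.meanCost_add_le _ _

lemma costRate_le (h : IsErgodicWalk P T s p) (a : ι → ℕ) :
    costRate P T s p a ≤ costBound P p * ∑ z, (a z : ℝ) := by
  have := (h.costRate_mul_le a 1).trans (h.integrable_and_meanCost_le (1 • a)).2
  simpa using this

lemma costRate_nsmul (h : IsErgodicWalk P T s p) (k : ℕ) (a : ι → ℕ) :
    costRate P T s p (k • a) = k * costRate P T s p a := by
  rcases Nat.eq_zero_or_pos k with rfl | hk
  · have h1 := h.costRate_le (0 • a)
    simp only [zero_smul, Pi.zero_apply, Nat.cast_zero, Finset.sum_const_zero, mul_zero] at h1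
    simpa using le_antisymm h1 (h.costRate_nonneg 0)
  have hk' : (k : ℝ) ≠ 0 := by exact_mod_cast hk.ne'
  refine tendsto_nhds_unique (h.tendsto_meanCost (k • a)) ?_
  have h1 := ((h.tendsto_meanCost a).comp
    (tendsto_id.atTop_mul_const' hk : Tendsto (fun n : ℕ => n * k) atTop atTop)).const_mul (k : ℝ)
  refine h1.congr fun n => ?_
  simp only [Function.comp, mul_smul, Nat.cast_mul]
  rw [mul_div_assoc', mul_comm (k : ℝ), mul_div_mul_right _ _ hk']

lemma costRate_congr {a b : ι → ℕ} (h1 : ∑ z, a z = ∑ z, b z) (h2 : endpoint s a = endpoint s b) :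
    costRate P T s p a = costRate P T s p b := by
  have : ∀ n : ℕ, meanCost P T s p (n • a) = meanCost P T s p (n • b) := fun n => by
    rw [meanCost, meanCost, IsWalk.pathCost_congr (a := n • a) (b := n • b)]
    · simp only [Pi.smul_apply, smul_eq_mul, ← Finset.mul_sum, h1]
    · rw [endpoint_nsmul, endpoint_nsmul, h2]
  simp only [costRate, this]

end IsErgodicWalk

end Walk

/-! ### The quenched limit along a positive type -/

section QuenchedLimit

variable {G : Type*} [AddCommGroup G] {ι : Type*} [Fintype ι] {Ω : Type*} [MeasurableSpace Ω]
  {P : Measure Ω} {T : G → Ω → Ω} {s : ι → G} {p : Ω → ι → ℝ}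

namespace IsErgodicWalk

/-- Shifting the environment by one step does not increase the asymptotic cost along a positive
type `a`: a walk that starts with the step `s z` and then follows `n • a` reaches the endpoint of
`(n + 1) • a` after the remaining steps of one more copy of `a`, at sublinear cost. -/
lemma ae_eventually_pathCost_lt [IsProbabilityMeasure P] (h : IsErgodicWalk P T s p) {a : ι → ℕ}
    (ha : ∀ z, 1 ≤ a z) (z : ι) :
    ∀ᵐ ω ∂P, ∀ c : ℝ, 0 ≤ c → ∀ δ : ℝ, 0 < δ → ∀ᶠ n : ℕ in atTop,
      pathCost T s p (n • a) (T (s z) ω) < c * n →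
        pathCost T s p ((n + 1) • a) ω < (c + δ) * (n + 1 : ℕ) := by
  classical
  have hle : Pi.single z 1 ≤ a := by
    intro w
    by_cases hw : w = z
    · subst hw; simpa using ha w
    · simp [hw]
  set b : ι → ℕ := a - Pi.single z 1 with hb
  filter_upwards [tendsto_orbit_div_atTop (h.measurable_pathCost b) (h.integrable_pathCost b)
    (h.pathCost_nonneg b) (τ := fun n : ℕ => T (n • endpoint s a + s z))
    (fun n => h.measurePreserving _)] with ω hω c hc δ hδ
  have h1 : Tendsto (fun n : ℕ => |Real.log (p ω z)| / n) atTop (𝓝 0) :=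
    tendsto_const_div_atTop_nhds_zero_nat _
  have h2 := h1.add hω
  rw [add_zero] at h2
  filter_upwards [(tendsto_order.1 h2).2 δ hδ, eventually_gt_atTop 0] with n hn hn0 hlt
  have hn0' : (0 : ℝ) < n := by exact_mod_cast hn0
  rw [← add_div, div_lt_iff₀ hn0'] at hn
  have e : (n + 1) • a = Pi.single z 1 + (n • a + b) := by
    rw [succ_nsmul, add_left_comm, hb, add_tsub_cancel_of_le hle]
  have h3 := h.pathCost_add_le (s := s) (Pi.single z 1) (n • a + b) ω
  have h4 := h.pathCost_add_le (s := s) (n • a) b (T (s z) ω)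
  have h5 := h.pathCost_single_le (s := s) z ω
  rw [endpoint_single, one_smul] at h3
  rw [endpoint_nsmul, ← h.map_add] at h4
  rw [e]
  push_cast
  nlinarith

/-- The upper half: almost surely the cost along a positive type grows at most at the mean rate. -/
lemma ae_eventually_lt [Countable G] [IsProbabilityMeasure P] (h : IsErgodicWalk P T s p)
    {a : ι → ℕ} (ha : ∀ z, 1 ≤ a z) {c : ℝ} (hc : costRate P T s p a < c) :
    ∀ᵐ ω ∂P, ∀ k : ℕ, ∀ᶠ n : ℕ in atTop, pathCost T s p (n • a) ω < (c + 1 / (k + 1)) * n := by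
  have hc0 : 0 ≤ c := (h.costRate_nonneg a).trans hc.le
  let B : Set Ω := {ω | ∀ k : ℕ, ∀ᶠ n : ℕ in atTop,
    pathCost T s p (n • a) ω < (c + 1 / (k + 1)) * n}
  have hBm : MeasurableSet B := by
    have : B = ⋂ k : ℕ, ⋃ N : ℕ, ⋂ n : ℕ, ⋂ _ : N ≤ n,
        {ω | pathCost T s p (n • a) ω < (c + 1 / (k + 1)) * n} := by
      ext ω
      simp only [B, Set.mem_ofPred_eq, Set.mem_iInter, Set.mem_iUnion, eventually_atTop]
    rw [this]
    exact MeasurableSet.iInter fun k => MeasurableSet.iUnion fun N => MeasurableSet.iInter fun n =>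
      MeasurableSet.iInter fun _ => measurableSet_lt (h.measurable_pathCost _) measurable_const
  have hinv : ∀ z, ∀ᵐ ω ∂P, T (s z) ω ∈ B → ω ∈ B := by
    intro z
    filter_upwards [h.ae_eventually_pathCost_lt ha z] with ω hω hωB k
    have h1 := hω (c + 1 / ((2 * k + 1 : ℕ) + 1)) (by positivity) (1 / ((2 * k + 1 : ℕ) + 1))
      (by positivity)
    have h2 : ∀ᶠ n : ℕ in atTop, pathCost T s p ((n + 1) • a) ω
        < (c + 1 / (k + 1)) * (n + 1 : ℕ) := by
      filter_upwards [h1, hωB (2 * k + 1)] with n h1 h2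
      have := h1 h2
      have e : (1 : ℝ) / ((2 * k + 1 : ℕ) + 1) + 1 / ((2 * k + 1 : ℕ) + 1) = 1 / (k + 1) := by
        push_cast; field_simp; ring
      rwa [add_assoc, e] at this
    obtain ⟨N, hN⟩ := eventually_atTop.1 h2
    refine eventually_atTop.2 ⟨N + 1, fun n hn => ?_⟩
    have := hN (n - 1) (by omega)
    rwa [Nat.sub_add_cancel (by omega)] at this
  rcases zero_or_one_of_ae_subinvariant h.closure_eq_top h.map_zero h.map_add h.measurePreserving
    h.zero_or_one hBm hinv with hP | hP
  swap
  · exact (mem_ae_iff_prob_eq_one hBm).2 hP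
  exfalso
  -- a block length whose mean cost per repetition is below `c`
  obtain ⟨m, hm, hm0⟩ := (((tendsto_order.1 (h.tendsto_meanCost a)).2 c hc).and
    (eventually_gt_atTop 0)).exists
  have hm0' : (0 : ℝ) < m := by exact_mod_cast hm0
  rw [div_lt_iff₀ hm0'] at hm
  let x := m • endpoint s a
  let r : Ω → ℝ := fun ω => ∑ i ∈ Finset.range m, pathCost T s p (i • a) ω
  let φ : ℕ → Ω → ℝ := fun n ω =>
    ∑ i ∈ Finset.range n, (pathCost T s p (m • a) ((T x)^[i] ω) - c * m)
  have hterm : ∀ i, Integrable (fun ω => pathCost T s p (m • a) ((T x)^[i] ω) - c * m) P :=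
    fun i => (((h.measurePreserving x).iterate i).integrable_comp_of_integrable
      (h.integrable_pathCost _)).sub (integrable_const _)
  have hφi : ∀ n, Integrable (φ n) P := fun n => integrable_finsetSum _ fun i _ => hterm i
  have hφm : ∀ n, Measurable (φ n) := fun n => Finset.measurable_fun_sum _ fun i _ =>
    (((h.measurable_pathCost _).comp ((h.measurePreserving x).iterate i).measurable).sub_const _)
  have hsup : ∀ k n ω, φ k ω + φ n ((T x)^[k] ω) ≤ φ (k + n) ω := by
    intro k n ω
    simp only [φ, Finset.sum_range_add]
    refine le_of_eq ?_
    congr 1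
    refine Finset.sum_congr rfl fun i _ => ?_
    rw [← Function.iterate_add_apply, add_comm]
  have hret : ∀ᵐ ω ∂P, ∃ n, 1 ≤ n ∧ 0 ≤ φ n ω := by
    have hBc : ∀ᵐ ω ∂P, ω ∉ B := measure_eq_zero_iff_ae_notMem.1 hP
    have hrm : Measurable r := Finset.measurable_fun_sum _ fun i _ => h.measurable_pathCost _
    have hri : Integrable r P := integrable_finsetSum _ fun i _ => h.integrable_pathCost _
    filter_upwards [hBc, tendsto_orbit_div_atTop hrm hri
      (fun ω => Finset.sum_nonneg fun i _ => h.pathCost_nonneg _ ω)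
      (τ := fun n : ℕ => T (n • x)) (fun n => h.measurePreserving _)] with ω hωB hω
    simp only [B, Set.mem_ofPred_eq, not_forall, not_eventually, not_lt] at hωB
    obtain ⟨k, hk⟩ := hωB
    have h1 := (Nat.tendsto_div_const_atTop hm0.ne').eventually
      (((tendsto_order.1 hω).2 (1 / (k + 1) * m) (by positivity)).and (eventually_gt_atTop 0))
    obtain ⟨n, hn, hn2, hn3⟩ := (hk.and_eventually h1).exists
    refine ⟨n / m, hn3, ?_⟩
    have hn3' : (0 : ℝ) < (n / m : ℕ) := by exact_mod_cast hn3
    rw [div_lt_iff₀ hn3'] at hn2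
    have e : n • a = (n / m) • (m • a) + (n % m) • a := by
      rw [← mul_smul, ← add_smul, Nat.div_add_mod']
    have h2 := h.pathCost_add_le (s := s) ((n / m) • (m • a)) ((n % m) • a) ω
    have h3 := h.pathCost_nsmul_le (s := s) (m • a) (n / m) ω
    have h4 : pathCost T s p ((n % m) • a) (T ((n / m) • x) ω) ≤ r (T ((n / m) • x) ω) :=
      Finset.single_le_sum (f := fun i => pathCost T s p (i • a) (T ((n / m) • x) ω))
        (fun i _ => h.pathCost_nonneg _ _) (Finset.mem_range.2 (Nat.mod_lt _ hm0))
    rw [← e] at h2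
    simp only [endpoint_nsmul] at h2 h3
    have h5 : ((n / m : ℕ) : ℝ) * m ≤ n := by exact_mod_cast Nat.div_mul_le_self n m
    have h6 : (c + 1 / (k + 1)) * ((n / m : ℕ) * m) ≤ (c + 1 / (k + 1)) * n :=
      mul_le_mul_of_nonneg_left h5 (by positivity)
    simp only [φ, Finset.sum_sub_distrib, Finset.sum_const, Finset.card_range, h.iterate_eq]
    rw [nsmul_eq_mul (n / m) (c * (m : ℝ))]
    have h7 : pathCost T s p ((n % m) • a) (T ((n / m) • m • endpoint s a) ω)
      ≤ r (T ((n / m) • x) ω) := h4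
    nlinarith
  have hε : 0 < (c * m - meanCost P T s p (m • a)) / 2 := by linarith
  obtain ⟨N, hN, hN0⟩ := ((superadditive_integral_ge (h.measurePreserving x) hφm hφi
    (fun ω => by simp [φ]) hsup hret hε).and (eventually_gt_atTop 0)).exists
  have hN0' : (0 : ℝ) < N := by exact_mod_cast hN0
  have hint : ∫ ω, φ N ω ∂P = N * (meanCost P T s p (m • a) - c * m) := by
    simp only [φ]
    rw [integral_finsetSum _ fun i _ => hterm i]
    have : ∀ i, ∫ ω, (pathCost T s p (m • a) ((T x)^[i] ω) - c * m) ∂P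
        = meanCost P T s p (m • a) - c * m := by
      intro i
      rw [integral_comp_iterate (h.measurePreserving x)
        (f := fun ω => pathCost T s p (m • a) ω - c * m) ((h.measurable_pathCost _).sub_const _),
        integral_sub (h.integrable_pathCost _) (integrable_const _)]
      simp [meanCost]
    simp only [this, Finset.sum_const, Finset.card_range]
    rw [nsmul_eq_mul]
  rw [hint] at hN
  nlinarith

/-- The lower half: almost surely the cost along a positive type grows at least at the mean rate. -/
lemma ae_eventually_ge [Countable G] [IsProbabilityMeasure P] (h : IsErgodicWalk P T s p)
    {a : ι → ℕ} (ha : ∀ z, 1 ≤ a z) {c : ℝ} (hc0 : 0 ≤ c) (hc : c < costRate P T s p a) :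
    ∀ᵐ ω ∂P, ∃ k : ℕ, ∀ᶠ n : ℕ in atTop, (c + 1 / (k + 1)) * n ≤ pathCost T s p (n • a) ω := by
  let A : Set Ω := {ω | ∀ k : ℕ, ∃ᶠ n : ℕ in atTop,
    pathCost T s p (n • a) ω < (c + 1 / (k + 1)) * n}
  have hAm : MeasurableSet A := by
    have : A = ⋂ k : ℕ, ⋂ N : ℕ, ⋃ n : ℕ, ⋃ _ : N ≤ n,
        {ω | pathCost T s p (n • a) ω < (c + 1 / (k + 1)) * n} := by
      ext ω
      simp only [A, Set.mem_ofPred_eq, Set.mem_iInter, Set.mem_iUnion, frequently_atTop,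
        exists_prop]
    rw [this]
    exact MeasurableSet.iInter fun k => MeasurableSet.iInter fun N => MeasurableSet.iUnion fun n =>
      MeasurableSet.iUnion fun _ => measurableSet_lt (h.measurable_pathCost _) measurable_const
  have hinv : ∀ z, ∀ᵐ ω ∂P, T (s z) ω ∈ A → ω ∈ A := by
    intro z
    filter_upwards [h.ae_eventually_pathCost_lt ha z] with ω hω hωA k
    have h1 := hω (c + 1 / ((2 * k + 1 : ℕ) + 1)) (by positivity) (1 / ((2 * k + 1 : ℕ) + 1))
      (by positivity)
    have h2 : ∃ᶠ n : ℕ in atTop, pathCost T s p ((n + 1) • a) ω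
        < (c + 1 / (k + 1)) * (n + 1 : ℕ) := by
      refine ((hωA (2 * k + 1)).and_eventually h1).mono fun n ⟨h2, h1⟩ => ?_
      have := h1 h2
      have e : (1 : ℝ) / ((2 * k + 1 : ℕ) + 1) + 1 / ((2 * k + 1 : ℕ) + 1) = 1 / (k + 1) := by
        push_cast; field_simp; ring
      rwa [add_assoc, e] at this
    exact (tendsto_add_atTop_nat 1).frequently h2
  rcases zero_or_one_of_ae_subinvariant h.closure_eq_top h.map_zero h.map_add h.measurePreserving
    h.zero_or_one hAm hinv with hP | hP
  · filter_upwards [measure_eq_zero_iff_ae_notMem.1 hP] with ω hω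
    simpa only [A, Set.mem_ofPred_eq, not_forall, not_frequently, not_lt] using hω
  exfalso
  obtain ⟨c', hcc', hc'⟩ := exists_between hc
  let x := endpoint s a
  let φ : ℕ → Ω → ℝ := fun n ω => c' * n - pathCost T s p (n • a) ω
  have hφi : ∀ n, Integrable (φ n) P :=
    fun n => (integrable_const _).sub (h.integrable_pathCost _)
  have hφm : ∀ n, Measurable (φ n) := fun n => (h.measurable_pathCost _).const_sub _
  have hsup : ∀ k n ω, φ k ω + φ n ((T x)^[k] ω) ≤ φ (k + n) ω := by
    intro k n ω
    have := h.pathCost_add_le (s := s) (k • a) (n • a) ω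
    rw [← add_smul, endpoint_nsmul] at this
    simp only [φ, h.iterate_eq]
    push_cast
    linarith
  have hret : ∀ᵐ ω ∂P, ∃ n, 1 ≤ n ∧ 0 ≤ φ n ω := by
    filter_upwards [(mem_ae_iff_prob_eq_one hAm).2 hP] with ω hω
    obtain ⟨k, hk⟩ := exists_nat_one_div_lt (sub_pos.2 hcc')
    obtain ⟨n, hn, hn0⟩ := ((hω k).and_eventually (eventually_gt_atTop 0)).exists
    refine ⟨n, hn0, ?_⟩
    have : (c + 1 / (k + 1)) * (n : ℝ) ≤ c' * n :=
      mul_le_mul_of_nonneg_right (by linarith) (Nat.cast_nonneg _)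
    simp only [φ]
    linarith
  have hε : 0 < (costRate P T s p a - c') / 2 := by linarith
  obtain ⟨N, hN, hN0⟩ := ((superadditive_integral_ge (h.measurePreserving x) hφm hφi
    (fun ω => by simp [φ, IsWalk.pathCost_zero]) hsup hret hε).and (eventually_gt_atTop 0)).exists
  have hN0' : (0 : ℝ) < N := by exact_mod_cast hN0
  have hint : ∫ ω, φ N ω ∂P = c' * N - meanCost P T s p (N • a) := by
    simp only [φ]
    rw [integral_sub (integrable_const _) (h.integrable_pathCost _)]
    simp [meanCost]
  rw [hint] at hN
  have := h.costRate_mul_le a N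
  nlinarith

/-- Almost surely the cost along every positive type grows at the deterministic mean rate. -/
theorem ae_tendsto_pathCost [Countable G] [IsProbabilityMeasure P] (h : IsErgodicWalk P T s p) :
    ∀ᵐ ω ∂P, ∀ a : ι → ℕ, (∀ z, 1 ≤ a z) →
      Tendsto (fun n : ℕ => pathCost T s p (n • a) ω / n) atTop (𝓝 (costRate P T s p a)) := by
  have hup : ∀ᵐ ω ∂P, ∀ a : ι → ℕ, (∀ z, 1 ≤ a z) → ∀ q : ℚ, costRate P T s p a < q →
      ∀ k : ℕ, ∀ᶠ n : ℕ in atTop, pathCost T s p (n • a) ω < (q + 1 / (k + 1)) * n := by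
    refine ae_all_iff.2 fun a => ?_
    by_cases ha : ∀ z, 1 ≤ a z
    · refine (ae_all_iff.2 fun q : ℚ => ?_).mono fun ω hω _ => hω
      by_cases hq : costRate P T s p a < q
      · exact (h.ae_eventually_lt ha hq).mono fun ω hω _ => hω
      · exact ae_of_all _ fun ω h' => absurd h' hq
    · exact ae_of_all _ fun ω h' => absurd h' ha
  have hlow : ∀ᵐ ω ∂P, ∀ a : ι → ℕ, (∀ z, 1 ≤ a z) → ∀ q : ℚ, (0 : ℝ) ≤ q →
      (q : ℝ) < costRate P T s p a →
      ∃ k : ℕ, ∀ᶠ n : ℕ in atTop, ((q : ℝ) + 1 / (k + 1)) * n ≤ pathCost T s p (n • a) ω := by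
    refine ae_all_iff.2 fun a => ?_
    by_cases ha : ∀ z, 1 ≤ a z
    · refine (ae_all_iff.2 fun q : ℚ => ?_).mono fun ω hω _ => hω
      by_cases hq : (0 : ℝ) ≤ q ∧ (q : ℝ) < costRate P T s p a
      · exact (h.ae_eventually_ge ha hq.1 hq.2).mono fun ω hω _ _ => hω
      · exact ae_of_all _ fun ω h1 h2 => absurd ⟨h1, h2⟩ hq
    · exact ae_of_all _ fun ω h' => absurd h' ha
  filter_upwards [hup, hlow] with ω hup hlow a ha
  refine tendsto_order.2 ⟨fun c hc => ?_, fun c hc => ?_⟩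
  · rcases lt_or_ge c 0 with hc0 | hc0
    · filter_upwards with n
      exact hc0.trans_le (div_nonneg (h.pathCost_nonneg _ _) (Nat.cast_nonneg _))
    obtain ⟨q, hcq, hq⟩ := exists_rat_btwn hc
    obtain ⟨k, hk⟩ := hlow a ha q (hc0.trans hcq.le) hq
    filter_upwards [hk, eventually_gt_atTop 0] with n hn hn0
    have hn0' : (0 : ℝ) < n := by exact_mod_cast hn0
    rw [lt_div_iff₀ hn0']
    refine lt_of_lt_of_le ?_ hn
    have : (0 : ℝ) < 1 / (k + 1) := by positivity
    gcongr
    linarith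
  · obtain ⟨q, hq, hqc⟩ := exists_rat_btwn hc
    obtain ⟨k, hk⟩ := exists_nat_one_div_lt (sub_pos.2 hqc)
    filter_upwards [hup a ha q hq k, eventually_gt_atTop 0] with n hn hn0
    have hn0' : (0 : ℝ) < n := by exact_mod_cast hn0
    rw [div_lt_iff₀ hn0']
    refine lt_of_lt_of_le hn ?_
    gcongr
    linarith

end IsErgodicWalk

end QuenchedLimit

/-! ### Extension of rates from lattice points to real vectors -/

section Envelope

variable {ι : Type*} [Fintype ι]

/-- The integer points of the kernel of an integer matrix stay within bounded distance of the
multiples of every real vector of the kernel.  Rounding down the multiples gives vectors on which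
the matrix takes finitely many values, so that one correction for each of these values suffices. -/
theorem exists_int_kernel_approx {κ : Type*} [Fintype κ] (A : ι → κ → ℤ) {v : ι → ℝ}
    (hv : ∀ i, ∑ z, v z * A z i = 0) :
    ∃ C : ℝ, ∀ n : ℕ, ∃ u : ι → ℤ, (∀ i, ∑ z, u z * A z i = 0) ∧ ∀ z, |(u z : ℝ) - n * v z| ≤ C := by
  classical
  let w : ℕ → ι → ℤ := fun n z => ⌊(n : ℝ) * v z⌋
  let ρ : ℕ → κ → ℤ := fun n i => ∑ z, w n z * A z i
  have hρ : ∀ n i, |ρ n i| ≤ ∑ z, |A z i| := by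
    intro n i
    have h1 : (ρ n i : ℝ) = -∑ z, Int.fract ((n : ℝ) * v z) * A z i := by
      have h2 : ∑ z, ((n : ℝ) * v z) * A z i = 0 := by
        simp only [mul_assoc, ← Finset.mul_sum, hv, mul_zero]
      have h3 : ∑ z, ((n : ℝ) * v z) * A z i
          = ∑ z, (w n z : ℝ) * A z i + ∑ z, Int.fract ((n : ℝ) * v z) * A z i := by
        rw [← Finset.sum_add_distrib]
        refine Finset.sum_congr rfl fun z _ => ?_
        rw [← add_mul, Int.floor_add_fract]
      simp only [ρ]
      push_cast
      linarith
    have h4 : |(ρ n i : ℝ)| ≤ ∑ z, |(A z i : ℝ)| := by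
      rw [h1, abs_neg]
      refine (Finset.abs_sum_le_sum_abs _ _).trans (Finset.sum_le_sum fun z _ => ?_)
      rw [abs_mul, abs_of_nonneg (Int.fract_nonneg _)]
      exact mul_le_of_le_one_left (abs_nonneg _) (Int.fract_lt_one _).le
    exact_mod_cast h4
  have hfin : (Set.range ρ).Finite := by
    refine (Set.finite_Icc (fun i => -∑ z, |A z i|) (fun i => ∑ z, |A z i|)).subset ?_
    rintro _ ⟨n, rfl⟩
    exact ⟨fun i => (abs_le.1 (hρ n i)).1, fun i => (abs_le.1 (hρ n i)).2⟩
  choose! j hj using fun r (hr : r ∈ Set.range ρ) => hr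
  refine ⟨1 + ∑ r ∈ hfin.toFinset, ∑ z, |(w (j r) z : ℝ)|, fun n => ⟨w n - w (j (ρ n)), ?_, ?_⟩⟩
  · intro i
    have := congrFun (hj (ρ n) ⟨n, rfl⟩) i
    simp only [Pi.sub_apply, sub_mul, Finset.sum_sub_distrib]
    simp only [ρ] at this ⊢
    omega
  · intro z
    have h1 : |(w n z : ℝ) - n * v z| ≤ 1 := by
      rw [abs_le]
      have h2 := Int.floor_le ((n : ℝ) * v z)
      have h3 := Int.lt_floor_add_one ((n : ℝ) * v z)
      constructor <;> simp only [w] <;> linarith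
    have h2 : |(w (j (ρ n)) z : ℝ)| ≤ ∑ r ∈ hfin.toFinset, ∑ z, |(w (j r) z : ℝ)| := by
      refine le_trans (Finset.single_le_sum (f := fun z => |(w (j (ρ n)) z : ℝ)|)
        (fun _ _ => abs_nonneg _) (Finset.mem_univ z)) ?_
      exact Finset.single_le_sum (f := fun r => ∑ z, |(w (j r) z : ℝ)|)
        (fun _ _ => Finset.sum_nonneg fun _ _ => abs_nonneg _)
        (hfin.mem_toFinset.2 ⟨n, rfl⟩)
    have h3 : ((w n - w (j (ρ n))) z : ℤ) - (n : ℝ) * v z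
        = ((w n z : ℝ) - n * v z) - w (j (ρ n)) z := by
      simp only [Pi.sub_apply]; push_cast; ring
    rw [h3]
    exact (abs_sub _ _).trans (add_le_add h1 h2)

/-- A subadditive and homogeneous function on types that is nonpositive and of at most linear
size. -/
structure IsSubadditiveRate (K : (ι → ℕ) → ℝ) (C : ℝ) : Prop where
  nonpos : ∀ a, K a ≤ 0
  add_le : ∀ a b, K (a + b) ≤ K a + K b
  nsmul : ∀ (k : ℕ) a, K (k • a) = k * K a
  neg_le : ∀ a, -(C * ∑ z, (a z : ℝ)) ≤ K a

/-- The values `K b / t` at the rational vectors `b / t` that exceed `α` in every coordinate. -/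
def envelopeSet (K : (ι → ℕ) → ℝ) (α : ι → ℝ) : Set ℝ :=
  {v | ∃ t : ℝ, 0 < t ∧ ∃ b : ι → ℕ, (∀ z, t * α z < b z) ∧ v = K b / t}

/-- The lower semicontinuous extension of `K` to real vectors.  Allowing only vectors that are
strictly larger in every coordinate gives the right value on the boundary of the orthant, where `K`
itself may jump. -/
def envelope (K : (ι → ℕ) → ℝ) (α : ι → ℝ) : ℝ := sSup (envelopeSet K α)

/-- The smallest integer vector that exceeds the nonnegative vector `α` in every coordinate. -/
def roundUp (α : ι → ℝ) : ι → ℕ := fun z => ⌊α z⌋₊ + 1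

omit [Fintype ι] in
lemma lt_roundUp (α : ι → ℝ) (z : ι) : α z < roundUp α z := by
  simpa [roundUp] using Nat.lt_floor_add_one (α z)

omit [Fintype ι] in
lemma roundUp_le {α : ι → ℝ} (hα : ∀ z, 0 ≤ α z) (z : ι) : (roundUp α z : ℝ) ≤ α z + 1 := by
  simpa [roundUp] using Nat.floor_le (hα z)

omit [Fintype ι] in
lemma envelopeSet_nonempty (K : (ι → ℕ) → ℝ) (α : ι → ℝ) : (envelopeSet K α).Nonempty :=
  ⟨_, 1, one_pos, roundUp α, fun z => by rw [one_mul]; exact lt_roundUp α z, rfl⟩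

omit [Fintype ι] in
lemma envelope_le {K : (ι → ℕ) → ℝ} {α : ι → ℝ} {c : ℝ}
    (hc : ∀ t : ℝ, 0 < t → ∀ b : ι → ℕ, (∀ z, t * α z < b z) → K b ≤ c * t) : envelope K α ≤ c := by
  refine csSup_le (envelopeSet_nonempty K α) ?_
  rintro _ ⟨t, ht, b, hb, rfl⟩
  rw [div_le_iff₀ ht]
  exact hc t ht b hb

namespace IsSubadditiveRate

variable {K : (ι → ℕ) → ℝ} {C : ℝ}

lemma bddAbove (h : IsSubadditiveRate K C) (α : ι → ℝ) : BddAbove (envelopeSet K α) :=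
  ⟨0, by rintro _ ⟨t, ht, b, _, rfl⟩; exact div_nonpos_of_nonpos_of_nonneg (h.nonpos b) ht.le⟩

lemma le_envelope (h : IsSubadditiveRate K C) {α : ι → ℝ} {t : ℝ} (ht : 0 < t) {b : ι → ℕ}
    (hb : ∀ z, t * α z < b z) : K b / t ≤ envelope K α :=
  le_csSup (h.bddAbove α) ⟨t, ht, b, hb, rfl⟩

lemma envelope_antitone (h : IsSubadditiveRate K C) {α β : ι → ℝ} (hαβ : ∀ z, α z ≤ β z) :
    envelope K β ≤ envelope K α := by
  refine envelope_le fun t ht b hb => ?_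
  rw [← div_le_iff₀ ht]
  exact h.le_envelope ht fun z => (mul_le_mul_of_nonneg_left (hαβ z) ht.le).trans_lt (hb z)

lemma neg_le_envelope (h : IsSubadditiveRate K C) {α : ι → ℝ} (hα : ∀ z, 0 ≤ α z) :
    -(C * ∑ z, α z) ≤ envelope K α := by
  have hlim : Tendsto (fun n : ℕ => -(C * ∑ z, (roundUp (n • α) z : ℝ)) / n) atTop
      (𝓝 (-(C * ∑ z, α z))) := by
    have h1 : ∀ z, Tendsto (fun n : ℕ => (roundUp (n • α) z : ℝ) / n) atTop (𝓝 (α z)) := by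
      intro z
      have h2 : Tendsto (fun n : ℕ => α z + 1 / (n : ℝ)) atTop (𝓝 (α z)) := by
        simpa using tendsto_const_nhds.add (tendsto_const_div_atTop_nhds_zero_nat (1 : ℝ))
      refine tendsto_of_tendsto_of_tendsto_of_le_of_le' tendsto_const_nhds h2 ?_ ?_ <;>
        filter_upwards [eventually_gt_atTop 0] with n hn <;>
        have hn' : (0 : ℝ) < n := by exact_mod_cast hn
      · rw [le_div_iff₀ hn']
        have : (n : ℝ) * α z < roundUp (n • α) z := by simpa using lt_roundUp (n • α) z
        linarith
      · rw [div_le_iff₀ hn', add_mul, one_div, inv_mul_cancel₀ hn'.ne']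
        have : (roundUp (n • α) z : ℝ) ≤ n * α z + 1 := by
          simpa using roundUp_le (α := n • α) (fun z => smul_nonneg (Nat.zero_le _) (hα z)) z
        linarith
    have h3 := ((tendsto_finsetSum Finset.univ fun z _ => h1 z).const_mul C).neg
    refine h3.congr fun n => ?_
    rw [← Finset.sum_div]; ring
  refine le_of_tendsto hlim ?_
  filter_upwards [eventually_gt_atTop 0] with n hn
  have hn' : (0 : ℝ) < n := by exact_mod_cast hn
  refine le_trans ?_ (h.le_envelope hn' (b := roundUp (n • α)) fun z => ?_)
  · gcongr
    exact h.neg_le _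
  · simpa using lt_roundUp (n • α) z

lemma envelope_smul (h : IsSubadditiveRate K C) {r : ℝ} (hr : 0 < r) (α : ι → ℝ) :
    envelope K (r • α) = r * envelope K α := by
  refine le_antisymm (envelope_le fun t ht b hb => ?_) ?_
  · have := h.le_envelope (α := α) (mul_pos ht hr) (b := b) fun z => by
      simpa [mul_assoc] using hb z
    rw [div_le_iff₀ (mul_pos ht hr)] at this
    linarith
  · rw [← le_div_iff₀' hr]
    refine envelope_le fun t ht b hb => ?_
    have := h.le_envelope (α := r • α) (div_pos ht hr) (b := b) fun z => by
      have e : t / r * (r * α z) = t * α z := by field_simp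
      simpa [e] using hb z
    rw [div_le_iff₀ (div_pos ht hr)] at this
    calc K b ≤ _ := this
      _ = _ := by ring

lemma envelope_add_le (h : IsSubadditiveRate K C) {α β : ι → ℝ} (hα : ∀ z, 0 ≤ α z)
    (hβ : ∀ z, 0 ≤ β z) : envelope K (α + β) ≤ envelope K α + envelope K β := by
  refine envelope_le fun t ht b hb => ?_
  -- split a large multiple `n • b` into two types that exceed the multiples of `α` and `β`
  have hev : ∀ᶠ n : ℕ in atTop, ∀ z, 1 < (n : ℝ) * (b z - t * (α z + β z)) := by
    refine eventually_all.2 fun z => ?_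
    have : 0 < (b z : ℝ) - t * (α z + β z) := sub_pos.2 (hb z)
    exact (tendsto_natCast_atTop_atTop.atTop_mul_const this).eventually_gt_atTop 1
  obtain ⟨n, hn, hn0⟩ := (hev.and (eventually_gt_atTop 0)).exists
  have hn0' : (0 : ℝ) < n := by exact_mod_cast hn0
  have hnt := mul_pos hn0' ht
  set c : ι → ℕ := roundUp ((n * t) • α) with hc
  have hc1 : ∀ z, (n * t) * α z < c z := fun z => by simpa using lt_roundUp ((n * t) • α) z
  have hc2 : ∀ z, (c z : ℝ) ≤ (n * t) * α z + 1 := fun z => by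
    simpa using roundUp_le (α := (n * t) • α) (fun z => mul_nonneg hnt.le (hα z)) z
  have hcb : c ≤ n • b := by
    intro z
    have h1 : (c z : ℝ) ≤ n * b z := by
      have := mul_nonneg hnt.le (hβ z)
      linarith [hn z, hc2 z]
    have h2 : c z ≤ n * b z := by exact_mod_cast h1
    simpa using h2
  obtain ⟨e, he⟩ : ∃ e, e = n • b - c := ⟨_, rfl⟩
  have hce : c + e = n • b := by rw [he]; exact add_tsub_cancel_of_le hcb
  have hez : ∀ z, (n * t) * β z < e z := fun z => by
    have h1 : (c z : ℝ) + e z = n * b z := by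
      have := congrFun hce z
      simp only [Pi.add_apply, Pi.smul_apply, smul_eq_mul] at this
      exact_mod_cast this
    linarith [hn z, hc2 z]
  have h1 := h.le_envelope hnt hc1
  have h2 := h.le_envelope hnt hez
  have h3 := h.add_le c e
  rw [hce, h.nsmul] at h3
  rw [div_le_iff₀ hnt] at h1 h2
  have h4 : (n : ℝ) * K b ≤ n * ((envelope K α + envelope K β) * t) := by linarith
  exact le_of_mul_le_mul_left h4 hn0'

/-- At a positive integer vector the extension has the original value. -/
lemma envelope_natCast (h : IsSubadditiveRate K C) {a : ι → ℕ} (ha : ∀ z, 1 ≤ a z) :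
    envelope K (fun z => (a z : ℝ)) = K a := by
  refine le_antisymm (envelope_le fun t ht b hb => ?_) ?_
  · have hn : ∀ n : ℕ, (n : ℝ) * K b ≤ ⌊t * n⌋₊ * K a := by
      intro n
      have hle : ⌊t * n⌋₊ • a ≤ n • b := by
        intro z
        have h1 : (⌊t * n⌋₊ : ℝ) * a z ≤ n * b z := by
          have h2 := Nat.floor_le (mul_nonneg ht.le (Nat.cast_nonneg n) : (0 : ℝ) ≤ t * n)
          have h3 : (⌊t * n⌋₊ : ℝ) * a z ≤ t * n * a z :=
            mul_le_mul_of_nonneg_right h2 (Nat.cast_nonneg _)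
          have h4 : (n : ℝ) * (t * a z) ≤ n * b z :=
            mul_le_mul_of_nonneg_left (hb z).le (Nat.cast_nonneg _)
          linarith
        have h2 : ⌊t * n⌋₊ * a z ≤ n * b z := by exact_mod_cast h1
        simpa using h2
      have h1 := h.add_le (⌊t * n⌋₊ • a) (n • b - ⌊t * n⌋₊ • a)
      rw [add_tsub_cancel_of_le hle, h.nsmul, h.nsmul] at h1
      linarith [h.nonpos (n • b - ⌊t * n⌋₊ • a)]
    have hlim : Tendsto (fun n : ℕ => (⌊t * n⌋₊ : ℝ) / n * K a) atTop (𝓝 (t * K a)) :=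
      ((tendsto_nat_floor_mul_div_atTop ht.le).comp tendsto_natCast_atTop_atTop).mul_const _
    rw [mul_comm]
    refine ge_of_tendsto hlim ?_
    filter_upwards [eventually_gt_atTop 0] with n hn0
    have hn0' : (0 : ℝ) < n := by exact_mod_cast hn0
    rw [div_mul_eq_mul_div, le_div_iff₀ hn0', mul_comm]
    exact hn n
  · have hlim : Tendsto (fun n : ℕ => K a + K a / (n : ℝ)) atTop (𝓝 (K a)) := by
      simpa using tendsto_const_nhds.add (tendsto_const_div_atTop_nhds_zero_nat (K a))
    refine le_of_tendsto hlim ?_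
    filter_upwards [eventually_gt_atTop 0] with n hn0
    have hn0' : (0 : ℝ) < n := by exact_mod_cast hn0
    have h1 := h.le_envelope (α := fun z => (a z : ℝ)) hn0' (b := (n + 1) • a) fun z => by
      have : (1 : ℝ) ≤ a z := by exact_mod_cast ha z
      simp only [Pi.smul_apply, smul_eq_mul]
      push_cast
      linarith
    rw [h.nsmul] at h1
    refine le_trans (le_of_eq ?_) h1
    push_cast
    field_simp

/-- The extension is continuous on the closed orthant.  Upper semicontinuity rests on the fact that
the vectors of the orthant that are close to `α` are at least `r • α` in every coordinate, for any
`r < 1`. -/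
lemma continuousOn_envelope (h : IsSubadditiveRate K C) :
    ContinuousOn (envelope K) {α | ∀ z, 0 ≤ α z} := by
  intro α hα
  refine tendsto_order.2 ⟨fun c hc => ?_, fun c hc => ?_⟩
  · obtain ⟨_, ⟨t, ht, b, hb, rfl⟩, hcv⟩ := exists_lt_of_lt_csSup (envelopeSet_nonempty K α) hc
    refine mem_nhdsWithin_of_mem_nhds ?_
    have : ∀ᶠ α' : ι → ℝ in 𝓝 α, ∀ z, t * α' z < b z := by
      refine eventually_all.2 fun z => ?_
      have hcont : Continuous fun α' : ι → ℝ => t * α' z := by fun_prop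
      exact (tendsto_order.1 hcont.continuousAt).2 _ (hb z)
    filter_upwards [this] with α' hα'
    exact hcv.trans_le (h.le_envelope ht hα')
  · obtain ⟨r, hr0, hr1, hrc⟩ : ∃ r : ℝ, 0 < r ∧ r < 1 ∧ r * envelope K α < c := by
      have hcont : Continuous fun r : ℝ => r * envelope K α := by fun_prop
      have h1 : ∀ᶠ r in 𝓝[<] (1 : ℝ), r * envelope K α < c :=
        mem_nhdsWithin_of_mem_nhds
          ((tendsto_order.1 (hcont.tendsto 1)).2 c (by simpa using hc))
      have h2 : ∀ᶠ r in 𝓝[<] (1 : ℝ), 0 < r :=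
        mem_nhdsWithin_of_mem_nhds (lt_mem_nhds one_pos)
      obtain ⟨r, ⟨h1, h2⟩, h3⟩ := ((h1.and h2).and self_mem_nhdsWithin).exists
      exact ⟨r, h2, h3, h1⟩
    have h1 : ∀ᶠ α' : ι → ℝ in 𝓝[{α | ∀ z, 0 ≤ α z}] α, ∀ z, (r • α) z ≤ α' z := by
      refine eventually_all.2 fun z => ?_
      rcases (hα z).eq_or_lt with h0 | h0
      · filter_upwards [self_mem_nhdsWithin] with α' hα'
        simpa [← h0] using hα' z
      · refine mem_nhdsWithin_of_mem_nhds ?_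
        have hcont : Continuous fun α' : ι → ℝ => α' z := by fun_prop
        filter_upwards [(tendsto_order.1 hcont.continuousAt).1 (r * α z) (by nlinarith)] with α' h'
        simpa using h'.le
    filter_upwards [h1] with α' hα'
    refine lt_of_le_of_lt (h.envelope_antitone hα') ?_
    rwa [h.envelope_smul hr0]

/-- If `K` depends on a type only through its image under an integer matrix, then so does the
extension. -/
lemma envelope_le_of_sum_eq (h : IsSubadditiveRate K C) {κ : Type*} [Fintype κ] (A : ι → κ → ℤ)
    (hK : ∀ a b : ι → ℕ, (∀ i, ∑ z, (a z : ℤ) * A z i = ∑ z, (b z : ℤ) * A z i) → K a = K b)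
    {α β : ι → ℝ} (hβ : ∀ z, 0 ≤ β z) (hαβ : ∀ i, ∑ z, α z * A z i = ∑ z, β z * A z i) :
    envelope K α ≤ envelope K β := by
  refine envelope_le fun t ht b hb => ?_
  obtain ⟨D, hD⟩ := exists_int_kernel_approx A (v := fun z => t * (β z - α z)) fun i => by
    simp only [mul_assoc, ← Finset.mul_sum, sub_mul, Finset.sum_sub_distrib, hαβ, sub_self,
      mul_zero]
  have hev : ∀ᶠ n : ℕ in atTop, ∀ z, D < (n : ℝ) * (b z - t * α z) := by
    refine eventually_all.2 fun z => ?_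
    exact (tendsto_natCast_atTop_atTop.atTop_mul_const (sub_pos.2 (hb z))).eventually_gt_atTop D
  obtain ⟨n, hn, hn0⟩ := (hev.and (eventually_gt_atTop 0)).exists
  have hn0' : (0 : ℝ) < n := by exact_mod_cast hn0
  obtain ⟨u, hu, huD⟩ := hD n
  have hd : ∀ z, (n * t) * β z < (n * b z + u z : ℝ) := by
    intro z
    have := (abs_le.1 (huD z)).1
    linarith [hn z]
  have hd0 : ∀ z, 0 ≤ (n * b z + u z : ℤ) := by
    intro z
    have h1 : (0 : ℝ) ≤ n * b z + u z := (mul_nonneg (mul_pos hn0' ht).le (hβ z)).trans (hd z).le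
    exact_mod_cast h1
  let e : ι → ℕ := fun z => (n * b z + u z : ℤ).toNat
  have he : ∀ z, (e z : ℤ) = n * b z + u z := fun z => Int.toNat_of_nonneg (hd0 z)
  have h1 : K e = n * K b := by
    rw [← h.nsmul]
    refine hK _ _ fun i => ?_
    simp only [he, add_mul, Finset.sum_add_distrib, hu, add_zero, Pi.smul_apply, smul_eq_mul]
    push_cast
    rfl
  have h2 := h.le_envelope (α := β) (mul_pos hn0' ht) (b := e) fun z => by
    have : (e z : ℝ) = n * b z + u z := by exact_mod_cast he z
    rw [this]; exact hd z
  rw [h1, div_le_iff₀ (mul_pos hn0' ht)] at h2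
  have h3 : (n : ℝ) * K b ≤ n * (envelope K β * t) := by linarith
  exact le_of_mul_le_mul_left h3 hn0'

end IsSubadditiveRate

end Envelope

/-! ### Short detours have small cost -/

section Detours

variable {G : Type*} [AddCommGroup G] {ι : Type*} [Fintype ι] {Ω : Type*}
  {T : G → Ω → Ω} {s : ι → G} {p : Ω → ι → ℝ}

/-- The pathwise form of the condition defining the class `𝓛`: in the environment `ω`, along straight
lines of length `ε n` that start within distance `n` of the origin and run in the direction of a step
`s z ≠ 0`, the sums of the costs of any single step `s w` are uniformly small compared to `n`. -/
def HasSmallLineSums (len : G → ℝ) (T : G → Ω → Ω) (s : ι → G) (p : Ω → ι → ℝ) (ω : Ω) : Prop :=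
  ∀ κ : ℝ, 0 < κ → ∃ ε : ℝ, 0 < ε ∧ ∀ᶠ n : ℕ in atTop, ∀ x : G, len x ≤ n → ∀ z, s z ≠ 0 → ∀ w,
    ∑ k ∈ Finset.range (⌊ε * n⌋₊ + 1), |Real.log (p (T (x + k • s z) ω) w)| ≤ κ * n

/-- In the environment `ω`, it costs little compared to `n` to take `m` to `2 m` steps of each kind
from a point that can be reached in `n` steps, if `m` is small compared to `n`. -/
def HasSmallDetours (T : G → Ω → Ω) (s : ι → G) (p : Ω → ι → ℝ) (ω : Ω) : Prop :=
  ∀ κ : ℝ, 0 < κ → ∃ ε : ℝ, 0 < ε ∧ ∀ᶠ n : ℕ in atTop, ∀ (a k : ι → ℕ) (m : ℕ),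
    ∑ z, a z ≤ n → (m : ℝ) ≤ ε * n → (∀ z, m ≤ k z ∧ k z ≤ 2 * m) →
      pathCost T s p k (T (endpoint s a) ω) ≤ κ * n

lemma endpoint_eq_zero {c : ι → ℕ} (hc : ∀ z, c z ≠ 0 → s z = 0) : endpoint s c = 0 := by
  refine Finset.sum_eq_zero fun z _ => ?_
  by_cases h : c z = 0
  · simp [h]
  · simp [hc z h]

namespace IsWalk

/-- The cost of steps that do not move. -/
lemma pathCost_le_of_steps_zero (h : IsWalk T p) (c : ι → ℕ) (hc : ∀ z, c z ≠ 0 → s z = 0) (ω : Ω) :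
    pathCost T s p c ω ≤ ∑ z, c z * |Real.log (p ω z)| := by
  classical
  induction c using type_induction with
  | zero => simp [pathCost_zero]
  | add a z ih =>
    have ha : ∀ w, a w ≠ 0 → s w = 0 := fun w hw => hc w (by simp [hw])
    refine (h.pathCost_add_le _ _ _).trans ?_
    rw [endpoint_eq_zero ha, h.map_zero]
    have e : ∑ w, (((a + Pi.single z 1 : ι → ℕ) w : ℕ) : ℝ) * |Real.log (p ω w)|
        = ∑ w, a w * |Real.log (p ω w)| + |Real.log (p ω z)| := by
      simp only [Pi.add_apply, Nat.cast_add, add_mul, Finset.sum_add_distrib]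
      congr 1
      rw [Finset.sum_eq_single z]
      · simp
      · intro w _ hw; simp [hw]
      · simp
    rw [e]
    exact add_le_add (ih ha) (h.pathCost_single_le z ω)

/-- The cost of a straight line of `k` steps `s z` along which up to `2 k` steps of each of the kinds
that do not move are interspersed, at most two at each point of the line. -/
lemma pathCost_line_le [DecidableEq ι] (h : IsWalk T p) (z : ι) (k : ℕ) (c : ι → ℕ)
    (hc : ∀ w, c w ≠ 0 → s w = 0) (hck : ∀ w, c w ≤ 2 * k) (ω : Ω) :
    pathCost T s p (Pi.single z k + c) ω
      ≤ ∑ i ∈ Finset.range k, 3 * ∑ w, |Real.log (p (T (i • s z) ω) w)| := by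
  induction k generalizing c with
  | zero =>
    have : (Pi.single z 0 + c : ι → ℕ) = 0 := by
      funext w
      have := hck w
      simp; omega
    rw [this, pathCost_zero, Finset.range_zero, Finset.sum_empty]
  | succ k ih =>
    let c₁ : ι → ℕ := fun w => min (c w) (2 * k)
    let c₂ : ι → ℕ := fun w => c w - min (c w) (2 * k)
    have hc₁ : ∀ w, c₁ w ≠ 0 → s w = 0 := fun w hw => hc w (by simp only [c₁] at hw; omega)
    have hc₂ : ∀ w, c₂ w ≠ 0 → s w = 0 := fun w hw => hc w (by simp only [c₂] at hw; omega)
    have e : (Pi.single z (k + 1) + c : ι → ℕ)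
        = (Pi.single z k + c₁) + (c₂ + Pi.single z 1) := by
      funext w
      rw [Pi.single_add]
      simp only [c₁, c₂, Pi.add_apply]
      omega
    have hend : endpoint s (Pi.single z k + c₁) = k • s z := by
      rw [endpoint_add, endpoint_single, endpoint_eq_zero hc₁, add_zero]
    have h1 := h.pathCost_add_le (s := s) (Pi.single z k + c₁) (c₂ + Pi.single z 1) ω
    rw [← e, hend] at h1
    have h2 := h.pathCost_add_le (s := s) c₂ (Pi.single z 1) (T (k • s z) ω)
    rw [endpoint_eq_zero hc₂, h.map_zero] at h2
    have h3 := h.pathCost_le_of_steps_zero c₂ hc₂ (T (k • s z) ω)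
    have h4 : ∑ w, (c₂ w : ℝ) * |Real.log (p (T (k • s z) ω) w)|
        ≤ 2 * ∑ w, |Real.log (p (T (k • s z) ω) w)| := by
      rw [Finset.mul_sum]
      refine Finset.sum_le_sum fun w _ => mul_le_mul_of_nonneg_right ?_ (abs_nonneg _)
      have : c₂ w ≤ 2 := by have := hck w; simp only [c₂]; omega
      exact_mod_cast this
    have h5 := h.pathCost_single_le (s := s) z (T (k • s z) ω)
    have h6 : |Real.log (p (T (k • s z) ω) z)| ≤ ∑ w, |Real.log (p (T (k • s z) ω) w)| :=
      Finset.single_le_sum (f := fun w => |Real.log (p (T (k • s z) ω) w)|)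
        (fun _ _ => abs_nonneg _) (Finset.mem_univ z)
    rw [Finset.sum_range_succ]
    have h7 := ih c₁ hc₁ (fun w => min_le_right _ _)
    linarith

lemma pathCost_sum_le (h : IsWalk T p) {κ : Type*} [DecidableEq κ] (b : κ → ι → ℕ) (S : Finset κ)
    {M : ℕ} {D : ℝ} {ω : Ω}
    (hD : ∀ a : ι → ℕ, ∑ z, a z ≤ M → ∀ j ∈ S, pathCost T s p (b j) (T (endpoint s a) ω) ≤ D)
    (a : ι → ℕ) (ha : ∑ z, a z + ∑ j ∈ S, ∑ z, b j z ≤ M) :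
    pathCost T s p (∑ j ∈ S, b j) (T (endpoint s a) ω) ≤ S.card * D := by
  induction S using Finset.induction_on generalizing a with
  | empty => simp [pathCost_zero]
  | insert j S hj ih =>
    rw [Finset.sum_insert hj] at ha ⊢
    rw [Finset.card_insert_of_notMem hj]
    refine (h.pathCost_add_le _ _ _).trans ?_
    rw [← h.map_add, add_comm (endpoint s (b j)), ← endpoint_add]
    have h1 := hD a (by omega) j (Finset.mem_insert_self _ _)
    have h2 := ih (fun a ha j hj => hD a ha j (Finset.mem_insert_of_mem hj)) (a + b j) (by
      simp only [Pi.add_apply, Finset.sum_add_distrib]; omega)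
    push_cast
    linarith

/-- A detour is made along straight lines, one for each kind of step that moves.  Steps that do not
move would be too costly if they were all taken at one point; they are spread over one of the
lines. -/
theorem hasSmallDetours (h : IsWalk T p) {len : G → ℝ} {L : ℕ} (hL : 1 ≤ L)
    (hlen : ∀ a : ι → ℕ, len (endpoint s a) ≤ L * (∑ z, a z : ℕ)) {ω : Ω}
    (hω : HasSmallLineSums len T s p ω) (hs : ∃ z, s z ≠ 0) : HasSmallDetours T s p ω := by
  classical
  obtain ⟨z₁, hz₁⟩ := hs
  intro κ hκ
  let N := Fintype.card ι
  have hN : 1 ≤ N := Fintype.card_pos_iff.2 ⟨z₁⟩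
  have hN' : (0 : ℝ) < N := by exact_mod_cast hN
  let Q := L * (1 + 2 * N)
  have hQ : 1 ≤ Q := Nat.mul_pos hL (by omega)
  have hQ' : (0 : ℝ) < Q := by exact_mod_cast hQ
  obtain ⟨ε, hε, hev⟩ := hω (κ / (3 * N * N * Q)) (by positivity)
  refine ⟨min 1 (ε / 2), by positivity, ?_⟩
  have hev' := (tendsto_id.const_mul_atTop' hQ : Tendsto (fun n : ℕ => Q * n) atTop atTop).eventually
    hev
  filter_upwards [hev'] with n hn a k m ha hm hk
  have hmn : m ≤ n := by
    have : (m : ℝ) ≤ n := hm.trans (mul_le_of_le_one_left (Nat.cast_nonneg _) (min_le_left _ _))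
    exact_mod_cast this
  have hm2 : 2 * m ≤ ⌊ε * ((Q * n : ℕ) : ℝ)⌋₊ := by
    refine Nat.le_floor ?_
    have h1 : (m : ℝ) ≤ ε / 2 * n := hm.trans (by gcongr; exact min_le_right _ _)
    have h2 : (n : ℝ) ≤ (Q * n : ℕ) := by
      have : n ≤ Q * n := Nat.le_mul_of_pos_left n hQ
      exact_mod_cast this
    have h3 : ε * (n : ℝ) ≤ ε * (Q * n : ℕ) := mul_le_mul_of_nonneg_left h2 hε.le
    push_cast at h3 ⊢
    linarith
  let S : Finset ι := Finset.univ.filter fun z => s z ≠ 0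
  let c : ι → ℕ := fun z => if s z = 0 then k z else 0
  let b : ι → ι → ℕ := fun z => Pi.single z (k z) + if z = z₁ then c else 0
  have hsum : ∑ z ∈ S, b z = k := by
    simp only [b, Finset.sum_add_distrib, Finset.sum_ite_eq']
    rw [if_pos (by simp [S, hz₁])]
    funext w
    simp only [Pi.add_apply, Finset.sum_apply, c]
    rw [Finset.sum_filter, Finset.sum_eq_single w]
    · by_cases hw : s w = 0 <;> simp [hw]
    · intro z _ hz
      split_ifs
      · rw [Pi.single_eq_of_ne hz.symm]
      · rfl
    · simp
  have hmass : ∑ z ∈ S, ∑ w, b z w = ∑ w, k w := by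
    rw [Finset.sum_comm]
    refine Finset.sum_congr rfl fun w _ => ?_
    rw [← Finset.sum_apply, hsum]
  have hkN : ∑ w, k w ≤ N * (2 * m) := by
    refine (Finset.sum_le_card_nsmul Finset.univ k (2 * m) fun z _ => (hk z).2).trans ?_
    rw [Finset.card_univ, smul_eq_mul]
  have hD : ∀ a' : ι → ℕ, ∑ z, a' z ≤ (1 + 2 * N) * n → ∀ z ∈ S,
      pathCost T s p (b z) (T (endpoint s a') ω) ≤ κ / N * n := by
    intro a' ha' z hz
    have hsz : s z ≠ 0 := (Finset.mem_filter.1 hz).2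
    have hc : ∀ w, (if z = z₁ then c else 0) w ≠ 0 → s w = 0 := by
      intro w hw
      by_contra hsw
      split_ifs at hw <;> simp [c, hsw] at hw
    have hck : ∀ w, (if z = z₁ then c else 0) w ≤ 2 * k z := by
      intro w
      have h1 := (hk w).2
      have h2 := (hk z).1
      split_ifs
      · simp only [c]; split_ifs <;> omega
      · simp
    refine (h.pathCost_line_le z (k z) _ hc hck _).trans ?_
    rw [← Finset.mul_sum, Finset.sum_comm]
    have hlen' : len (endpoint s a') ≤ (Q * n : ℕ) := by
      refine (hlen a').trans ?_
      have : L * ∑ z, a' z ≤ Q * n := by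
        calc L * ∑ z, a' z ≤ L * ((1 + 2 * N) * n) := Nat.mul_le_mul_left _ ha'
          _ = Q * n := by simp only [Q]; ring
      exact_mod_cast this
    have hw : ∀ w, ∑ i ∈ Finset.range (k z), |Real.log (p (T (i • s z) (T (endpoint s a') ω)) w)|
        ≤ κ / (3 * N * N * Q) * (Q * n : ℕ) := by
      intro w
      refine le_trans ?_ (hn _ hlen' z hsz w)
      have e : ∀ i : ℕ, T (i • s z) (T (endpoint s a') ω) = T (endpoint s a' + i • s z) ω :=
        fun i => by rw [← h.map_add, add_comm]
      simp only [e]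
      refine Finset.sum_le_sum_of_subset_of_nonneg ?_ fun _ _ _ => abs_nonneg _
      intro i hi
      have := (hk z).2
      simp only [Finset.mem_range] at hi ⊢
      omega
    have h1 := Finset.sum_le_card_nsmul Finset.univ _ _ fun w _ => hw w
    rw [Finset.card_univ, nsmul_eq_mul] at h1
    refine (mul_le_mul_of_nonneg_left h1 (by norm_num : (0 : ℝ) ≤ 3)).trans (le_of_eq ?_)
    simp only [N] at hN' ⊢
    push_cast
    field_simp
  have hfin := h.pathCost_sum_le b S hD a (by
    rw [hmass]
    have : N * (2 * m) ≤ N * (2 * n) := Nat.mul_le_mul_left _ (by omega)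
    linarith)
  rw [hsum] at hfin
  refine hfin.trans ?_
  have hcard : (S.card : ℝ) ≤ N := by exact_mod_cast Finset.card_le_univ S
  calc (S.card : ℝ) * (κ / N * n) ≤ N * (κ / N * n) := by gcongr
    _ = κ * n := by field_simp

end IsWalk

end Detours

/-! ### Uniform estimates in a typical environment -/

section Uniform

variable {G : Type*} [AddCommGroup G] {ι : Type*} [Fintype ι] {Ω : Type*} [MeasurableSpace Ω]
  {P : Measure Ω} {T : G → Ω → Ω} {s : ι → G} {p : Ω → ι → ℝ}

/-- The cost rate minus its linear bound. -/
def reducedRate (P : Measure Ω) (T : G → Ω → Ω) (s : ι → G) (p : Ω → ι → ℝ) (a : ι → ℕ) : ℝ :=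
  costRate P T s p a - costBound P p * ∑ z, (a z : ℝ)

/-- The asymptotic cost per unit of time of moving with frequency `α z` in the direction of the
step `z`. -/
def limitRate (P : Measure Ω) (T : G → Ω → Ω) (s : ι → G) (p : Ω → ι → ℝ) (α : ι → ℝ) : ℝ :=
  envelope (reducedRate P T s p) α + costBound P p * ∑ z, α z

namespace IsErgodicWalk

lemma isSubadditiveRate (h : IsErgodicWalk P T s p) :
    IsSubadditiveRate (reducedRate P T s p) (costBound P p) where
  nonpos a := sub_nonpos.2 (h.costRate_le a)
  add_le a b := by
    have := h.costRate_add_le a b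
    simp only [reducedRate, Pi.add_apply, Nat.cast_add, Finset.sum_add_distrib]
    linarith
  nsmul k a := by
    simp only [reducedRate, h.costRate_nsmul, Pi.smul_apply, smul_eq_mul, Nat.cast_mul,
      ← Finset.mul_sum]
    ring
  neg_le a := by
    have := h.costRate_nonneg a
    simp only [reducedRate]
    linarith

lemma limitRate_nonneg (h : IsErgodicWalk P T s p) {α : ι → ℝ} (hα : ∀ z, 0 ≤ α z) :
    0 ≤ limitRate P T s p α := by
  have := h.isSubadditiveRate.neg_le_envelope hα
  rw [limitRate]
  linarith

lemma limitRate_smul (h : IsErgodicWalk P T s p) {r : ℝ} (hr : 0 < r) (α : ι → ℝ) :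
    limitRate P T s p (r • α) = r * limitRate P T s p α := by
  simp only [limitRate, h.isSubadditiveRate.envelope_smul hr, Pi.smul_apply, smul_eq_mul,
    ← Finset.mul_sum]
  ring

lemma limitRate_add_le (h : IsErgodicWalk P T s p) {α β : ι → ℝ} (hα : ∀ z, 0 ≤ α z)
    (hβ : ∀ z, 0 ≤ β z) :
    limitRate P T s p (α + β) ≤ limitRate P T s p α + limitRate P T s p β := by
  have := h.isSubadditiveRate.envelope_add_le hα hβ
  simp only [limitRate, Pi.add_apply, Finset.sum_add_distrib]
  linarith

lemma limitRate_natCast (h : IsErgodicWalk P T s p) {a : ι → ℕ} (ha : ∀ z, 1 ≤ a z) :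
    limitRate P T s p (fun z => (a z : ℝ)) = costRate P T s p a := by
  rw [limitRate, h.isSubadditiveRate.envelope_natCast ha, reducedRate]
  ring

lemma continuousOn_limitRate (h : IsErgodicWalk P T s p) :
    ContinuousOn (limitRate P T s p) {α | ∀ z, 0 ≤ α z} := by
  unfold limitRate
  exact h.isSubadditiveRate.continuousOn_envelope.add (by fun_prop)

/-- The limit rate depends only on the total mass and on the mean displacement. -/
lemma limitRate_congr (h : IsErgodicWalk P T s p) {κ : Type*} [Fintype κ] (A : ι → κ → ℤ)
    (hA : ∀ a b : ι → ℕ, (∀ i, ∑ z, (a z : ℤ) * A z i = ∑ z, (b z : ℤ) * A z i) →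
      ∑ z, a z = ∑ z, b z ∧ endpoint s a = endpoint s b)
    {α β : ι → ℝ} (hα : ∀ z, 0 ≤ α z) (hβ : ∀ z, 0 ≤ β z) (hmass : ∑ z, α z = ∑ z, β z)
    (hαβ : ∀ i, ∑ z, α z * A z i = ∑ z, β z * A z i) :
    limitRate P T s p α = limitRate P T s p β := by
  have hK : ∀ a b : ι → ℕ, (∀ i, ∑ z, (a z : ℤ) * A z i = ∑ z, (b z : ℤ) * A z i) →
      reducedRate P T s p a = reducedRate P T s p b := by
    intro a b hab
    obtain ⟨h1, h2⟩ := hA a b hab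
    have h3 : ∑ z, (a z : ℝ) = ∑ z, (b z : ℝ) := by exact_mod_cast h1
    rw [reducedRate, reducedRate, costRate_congr h1 h2, h3]
  rw [limitRate, limitRate, hmass]
  congr 1
  exact le_antisymm (h.isSubadditiveRate.envelope_le_of_sum_eq A hK hβ hαβ)
    (h.isSubadditiveRate.envelope_le_of_sum_eq A hK hα fun i => (hαβ i).symm)

/-- The environments in which the costs along all positive types have their limits and short detours
are cheap. -/
def IsTypical (P : Measure Ω) (T : G → Ω → Ω) (s : ι → G) (p : Ω → ι → ℝ) (ω : Ω) : Prop :=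
  HasSmallDetours T s p ω ∧ ∀ a : ι → ℕ, (∀ z, 1 ≤ a z) →
    Tendsto (fun n : ℕ => pathCost T s p (n • a) ω / n) atTop (𝓝 (costRate P T s p a))

/-- Comparison of a type `b` of `n` steps with multiples of finitely many types: if `N` is large,
then for every positive type `a` such that `(n / N) • a` is within `2 (n / N)` of `b` in every
coordinate, the cost of this multiple is close to `n` times the limit rate of the frequencies
`b / n`. -/
lemma eventually_multiple_near (h : IsErgodicWalk P T s p) {ω : Ω} (hω : IsTypical P T s p ω)
    {κ ε : ℝ} (hκ : 0 < κ) (hε : 0 < ε) :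
    ∃ N : ℕ, 0 < N ∧ 1 / (N : ℝ) ≤ ε ∧ ∀ᶠ n : ℕ in atTop, 0 < n / N ∧ ∀ a b : ι → ℕ, ∑ z, b z = n →
      (∀ z, 1 ≤ a z ∧ b z ≤ (n / N) * a z + 2 * (n / N) ∧ (n / N) * a z ≤ b z + 2 * (n / N)) →
      |pathCost T s p ((n / N) • a) ω - n * limitRate P T s p (fun z => (b z : ℝ) / n)| ≤ κ * n := by
  have hcomp : IsCompact (Set.Icc (fun _ : ι => (0 : ℝ)) (fun _ => 3)) := isCompact_Icc
  have huc := Metric.uniformContinuousOn_iff.1 (hcomp.uniformContinuousOn_of_continuous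
    (h.continuousOn_limitRate.mono fun α hα z => hα.1 z))
  obtain ⟨δ, hδ, huc⟩ := huc (κ / 2) (by positivity)
  obtain ⟨N₁, hN₁⟩ := exists_nat_gt (max (1 / ε) (2 / δ))
  have hN0 : (0 : ℝ) < N₁ := lt_of_le_of_lt (le_max_of_le_left (by positivity)) hN₁
  have hN0' : 0 < N₁ := by exact_mod_cast hN0
  have hNε : 1 / (N₁ : ℝ) ≤ ε := by
    rw [div_le_iff₀ hN0]
    have := (le_max_left _ _).trans_lt hN₁
    rw [div_lt_iff₀ hε] at this
    linarith
  have hNδ : 2 / (N₁ : ℝ) < δ := by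
    rw [div_lt_iff₀ hN0]
    have := (le_max_right _ _).trans_lt hN₁
    rw [div_lt_iff₀ hδ] at this
    linarith
  refine ⟨N₁, hN0', hNε, ?_⟩
  classical
  let F : Finset (ι → ℕ) := Fintype.piFinset fun _ => Finset.Icc 1 (2 * N₁ + 2)
  have hF : ∀ᶠ m : ℕ in atTop, ∀ a ∈ F,
      |pathCost T s p (m • a) ω - m * costRate P T s p a| ≤ κ / 2 * m := by
    refine (Filter.eventually_all_finset F).2 fun a ha => ?_
    have ha1 : ∀ z, 1 ≤ a z := fun z => (Finset.mem_Icc.1 (Fintype.mem_piFinset.1 ha z)).1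
    filter_upwards [(Metric.tendsto_nhds.1 (hω.2 a ha1)) (κ / 2) (by positivity),
      eventually_gt_atTop 0] with m hm hm0
    have hm0' : (0 : ℝ) < m := by exact_mod_cast hm0
    rw [Real.dist_eq] at hm
    have e : pathCost T s p (m • a) ω - m * costRate P T s p a
        = (pathCost T s p (m • a) ω / m - costRate P T s p a) * m := by field_simp
    rw [e, abs_mul, abs_of_pos hm0']
    exact mul_le_mul_of_nonneg_right hm.le hm0'.le
  have hdiv := (Nat.tendsto_div_const_atTop hN0'.ne').eventually
    (hF.and (eventually_gt_atTop 0))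
  filter_upwards [hdiv] with n hn
  obtain ⟨hnF, hm0⟩ := hn
  refine ⟨hm0, fun a b hb hab => ?_⟩
  set m := n / N₁ with hm
  have hmN : m * N₁ ≤ n := Nat.div_mul_le_self n N₁
  have hnm : n ≤ 2 * N₁ * m := by
    have h1 : n < N₁ * (m + 1) := by
      rw [hm]; exact Nat.lt_mul_div_succ n hN0'
    nlinarith
  have hm0' : (0 : ℝ) < m := by exact_mod_cast hm0
  have hn0 : 0 < n := lt_of_lt_of_le (Nat.mul_pos hm0 hN0') hmN
  have hn0' : (0 : ℝ) < n := by exact_mod_cast hn0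
  have hmN' : (m : ℝ) * N₁ ≤ n := by exact_mod_cast hmN
  have hmn : m ≤ n := (Nat.le_mul_of_pos_right m hN0').trans hmN
  have hbn : ∀ z, b z ≤ n := fun z => by
    rw [← hb]; exact Finset.single_le_sum (fun _ _ => Nat.zero_le _) (Finset.mem_univ z)
  have haF : a ∈ F := by
    refine Fintype.mem_piFinset.2 fun z => Finset.mem_Icc.2 ⟨(hab z).1, ?_⟩
    have h1 := (hab z).2.2
    have h2 := hbn z
    have h3 : m * a z ≤ m * (2 * N₁ + 2) := by nlinarith
    exact Nat.le_of_mul_le_mul_left h3 hm0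
  have h1 := hnF a haF
  have hrate : (n : ℝ) * limitRate P T s p (fun z => (m * a z : ℝ) / n)
      = m * costRate P T s p a := by
    have : (fun z => (m * a z : ℝ) / n) = ((m : ℝ) / n) • fun z => (a z : ℝ) := by
      funext z; simp only [Pi.smul_apply, smul_eq_mul]; ring
    rw [this, h.limitRate_smul (by positivity), h.limitRate_natCast fun z => (hab z).1]
    field_simp
  have hclose := huc (fun z => (m * a z : ℝ) / n) ⟨fun z => by positivity, fun z => by
      change (m * a z : ℝ) / n ≤ 3
      rw [div_le_iff₀ hn0']
      have h2 := (hab z).2.2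
      have h3 := hbn z
      have : m * a z ≤ 3 * n := by omega
      exact_mod_cast this⟩
    (fun z => (b z : ℝ) / n) ⟨fun z => by positivity, fun z => by
      change (b z : ℝ) / n ≤ 3
      rw [div_le_iff₀ hn0']
      have : b z ≤ 3 * n := by have := hbn z; omega
      exact_mod_cast this⟩ (by
    refine (dist_pi_lt_iff hδ).2 fun z => lt_of_le_of_lt ?_ hNδ
    rw [Real.dist_eq, ← sub_div, abs_div, abs_of_pos hn0', div_le_div_iff₀ hn0' hN0]
    have h2 : (b z : ℝ) ≤ m * a z + 2 * m := by exact_mod_cast (hab z).2.1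
    have h3 : (m : ℝ) * a z ≤ b z + 2 * m := by exact_mod_cast (hab z).2.2
    have h4 : |(m : ℝ) * a z - b z| ≤ 2 * m := abs_le.2 ⟨by linarith, by linarith⟩
    nlinarith)
  rw [Real.dist_eq] at hclose
  have h5 : |m * costRate P T s p a - n * limitRate P T s p (fun z => (b z : ℝ) / n)|
      ≤ κ / 2 * n := by
    rw [← hrate, ← mul_sub, abs_mul, abs_of_pos hn0', mul_comm]
    exact mul_le_mul_of_nonneg_right hclose.le hn0'.le
  have h6 : κ / 2 * (m : ℝ) ≤ κ / 2 * n := by gcongr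
  have h7 := abs_add_le (pathCost T s p (m • a) ω - m * costRate P T s p a)
    (m * costRate P T s p a - n * limitRate P T s p (fun z => (b z : ℝ) / n))
  rw [sub_add_sub_cancel] at h7
  linarith

/-- Uniform lower bound for the costs of all types: from the endpoint of a type, a short detour leads
to the endpoint of a multiple of one of finitely many positive types. -/
theorem eventually_le_pathCost (h : IsErgodicWalk P T s p) {ω : Ω} (hω : IsTypical P T s p ω)
    {κ : ℝ} (hκ : 0 < κ) :
    ∀ᶠ n : ℕ in atTop, ∀ b : ι → ℕ, ∑ z, b z = n →
      n * (limitRate P T s p (fun z => (b z : ℝ) / n) - κ) ≤ pathCost T s p b ω := by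
  obtain ⟨ε, hε, hdet⟩ := hω.1 (κ / 2) (by positivity)
  obtain ⟨N, hN, hNε, hev⟩ := h.eventually_multiple_near hω (κ := κ / 2) (by positivity) hε
  have hN' : (0 : ℝ) < N := by exact_mod_cast hN
  filter_upwards [hev, hdet] with n ⟨hm0, hn⟩ hdet b hb
  set m := n / N with hm
  let a : ι → ℕ := fun z => b z / m + 2
  have hma : ∀ z, b z + m ≤ m * a z ∧ m * a z ≤ b z + 2 * m := by
    intro z
    have h1 := Nat.div_add_mod (b z) m
    have h2 := Nat.mod_lt (b z) hm0
    simp only [a, mul_add]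
    omega
  have hle : b ≤ m • a := fun z => by
    have := (hma z).1
    simp only [Pi.smul_apply, smul_eq_mul]
    omega
  have h1 := hn a b hb fun z =>
    ⟨Nat.le_add_left_of_le one_le_two, by have := hma z; omega, (hma z).2⟩
  have hmε : (m : ℝ) ≤ ε * n := by
    have h2 : (m : ℝ) * N ≤ n := by exact_mod_cast Nat.div_mul_le_self n N
    have h3 : (m : ℝ) ≤ 1 / N * n := by
      rw [div_mul_eq_mul_div, one_mul, le_div_iff₀ hN']; exact h2
    exact h3.trans (by gcongr)
  have h2 := hdet b (m • a - b) m hb.le hmε fun z => by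
    have := hma z
    simp only [Pi.sub_apply, Pi.smul_apply, smul_eq_mul]
    omega
  have h3 := h.pathCost_add_le (s := s) b (m • a - b) ω
  rw [add_tsub_cancel_of_le hle] at h3
  have h4 := (abs_le.1 h1).1
  linarith

/-- Uniform upper bound for the costs of types with proportions bounded away from zero: their
endpoints are a short detour away from the endpoints of multiples of finitely many positive
types. -/
theorem eventually_pathCost_le (h : IsErgodicWalk P T s p) {ω : Ω} (hω : IsTypical P T s p ω)
    {κ η : ℝ} (hκ : 0 < κ) (hη : 0 < η) :
    ∀ᶠ n : ℕ in atTop, ∀ b : ι → ℕ, ∑ z, b z = n → (∀ z, η * n ≤ b z) →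
      pathCost T s p b ω ≤ n * (limitRate P T s p (fun z => (b z : ℝ) / n) + κ) := by
  obtain ⟨ε, hε, hdet⟩ := hω.1 (κ / 2) (by positivity)
  obtain ⟨N, hN, hNε, hev⟩ := h.eventually_multiple_near hω (κ := κ / 2) (ε := min ε (η / 2))
    (by positivity) (by positivity)
  have hN' : (0 : ℝ) < N := by exact_mod_cast hN
  filter_upwards [hev, hdet] with n ⟨hm0, hn⟩ hdet b hb hbη
  set m := n / N with hm
  have hmN : (m : ℝ) ≤ 1 / N * n := by
    have h2 : (m : ℝ) * N ≤ n := by exact_mod_cast Nat.div_mul_le_self n N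
    rw [div_mul_eq_mul_div, one_mul, le_div_iff₀ hN']; exact h2
  have hmb : ∀ z, 2 * m ≤ b z := by
    intro z
    have h1 : (m : ℝ) ≤ η / 2 * n := hmN.trans
      (mul_le_mul_of_nonneg_right (hNε.trans (min_le_right _ _)) (Nat.cast_nonneg _))
    have h2 : (2 * m : ℝ) ≤ b z := by linarith [hbη z]
    exact_mod_cast h2
  let a : ι → ℕ := fun z => b z / m - 1
  have hma : ∀ z, 1 ≤ a z ∧ m * a z + m ≤ b z ∧ b z ≤ m * a z + 2 * m := by
    intro z
    have h1 := Nat.div_add_mod (b z) m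
    have h2 := Nat.mod_lt (b z) hm0
    have h3 : 2 ≤ b z / m := (Nat.le_div_iff_mul_le hm0).2 (hmb z)
    have h4 : m * a z + m = m * (b z / m) := by
      simp only [a]
      rw [← Nat.mul_succ]
      congr 1
      omega
    refine ⟨by simp only [a]; omega, by omega, by omega⟩
  have hle : m • a ≤ b := fun z => by
    have := (hma z).2.1
    simp only [Pi.smul_apply, smul_eq_mul]
    omega
  have h1 := hn a b hb fun z => ⟨(hma z).1, (hma z).2.2, by have := hma z; omega⟩
  have hmε : (m : ℝ) ≤ ε * n := hmN.trans
    (mul_le_mul_of_nonneg_right (hNε.trans (min_le_left _ _)) (Nat.cast_nonneg _))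
  have hmass : ∑ z, (m • a) z ≤ n := by
    rw [← hb]; exact Finset.sum_le_sum fun z _ => hle z
  have h2 := hdet (m • a) (b - m • a) m hmass hmε fun z => by
    have := hma z
    simp only [Pi.sub_apply, Pi.smul_apply, smul_eq_mul]
    omega
  have h3 := h.pathCost_add_le (s := s) (m • a) (b - m • a) ω
  rw [add_tsub_cancel_of_le hle] at h3
  have h4 := (abs_le.1 h1).2
  linarith

end IsErgodicWalk

end Uniform

/-! ### The lattice walk and its path measure -/

section Lattice

variable {d : ℕ} {R : Finset (Fin d → ℤ)} {Ω : Type*}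

/-- The inclusion of the lattice as a homomorphism. -/
def toEHom (d : ℕ) : (Fin d → ℤ) →+ EuclideanSpace ℝ (Fin d) where
  toFun := toE
  map_zero' := by ext i; simp [toE]
  map_add' x y := by ext i; simp [toE]

lemma toE_apply (x : Fin d → ℤ) (i : Fin d) : toE x i = x i := rfl

lemma coe_endpoint (a : R → ℕ) :
    ((endpoint step a : stepGroup R) : Fin d → ℤ) = ∑ z : R, a z • (z : Fin d → ℤ) := by
  simp [endpoint, step]

lemma toE_endpoint (a : R → ℕ) :
    toE ((endpoint step a : stepGroup R) : Fin d → ℤ)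
      = ∑ z : R, (a z : ℝ) • toE (z : Fin d → ℤ) := by
  rw [coe_endpoint]
  change toEHom d _ = _
  rw [map_sum]
  refine Finset.sum_congr rfl fun z _ => ?_
  rw [map_nsmul, Nat.cast_smul_eq_nsmul]
  rfl

lemma closure_range_step : AddSubgroup.closure (Set.range (step (R := R))) = ⊤ := by
  have h := AddSubgroup.closure_closure_coe_preimage (k := (R : Set (Fin d → ℤ)))
  rw [← h]
  congr 1
  ext x
  constructor
  · rintro ⟨z, rfl⟩
    exact z.2
  · intro hx
    exact ⟨⟨x, hx⟩, rfl⟩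

lemma exists_norm_endpoint_le (R : Finset (Fin d → ℤ)) : ∃ L : ℕ, 1 ≤ L ∧ ∀ a : R → ℕ,
    ‖toE ((endpoint step a : stepGroup R) : Fin d → ℤ)‖ ≤ L * (∑ z, a z : ℕ) := by
  obtain ⟨L, hL⟩ := exists_nat_ge (∑ z : R, ‖toE (z : Fin d → ℤ)‖)
  refine ⟨L + 1, by omega, fun a => ?_⟩
  rw [toE_endpoint]
  refine (norm_sum_le _ _).trans ?_
  push_cast
  rw [Finset.mul_sum]
  refine Finset.sum_le_sum fun z _ => ?_
  rw [norm_smul, Real.norm_natCast, mul_comm]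
  refine mul_le_mul_of_nonneg_right ?_ (Nat.cast_nonneg _)
  have := Finset.single_le_sum (f := fun z : R => ‖toE (z : Fin d → ℤ)‖)
    (fun _ _ => norm_nonneg _) (Finset.mem_univ z)
  linarith

variable {T : stepGroup R → Ω → Ω} {p : Ω → stdSimplex ℝ R}

/-- The law of the position after `n` steps under the path measure is given by the transition
probabilities: both satisfy the recursion that conditions on the last step. -/
lemma map_traj_singleton (h : IsWalk T (fun ω (z : R) => p ω z)) (ω : Ω) (n : ℕ)
    (y : stepGroup R) :
    ((Kernel.traj (X := fun _ => stepGroup R) (pastKernel T p ω) 0 (fun _ => 0)).map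
      (fun X => X n)) {y} = ENNReal.ofReal (stepProb T step (fun ω (z : R) => p ω z) n ω y) := by
  have hpart : ∀ n, (Kernel.traj (X := fun _ => stepGroup R) (pastKernel T p ω) 0
      (fun _ => 0)).map (fun X => X n) = (Kernel.partialTraj (X := fun _ => stepGroup R)
        (pastKernel T p ω) 0 n (fun _ => 0)).map (fun X => X ⟨n, Finset.mem_Iic.2 le_rfl⟩) := by
    intro n
    rw [← Kernel.traj_map_frestrictLe_apply, Measure.map_map (measurable_pi_apply _)
      (by fun_prop)]
    rfl
  induction n generalizing y with
  | zero =>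
    rw [hpart, Kernel.partialTraj_self, Kernel.id_apply,
      Measure.map_dirac' (measurable_pi_apply _), Measure.dirac_apply' _ (measurableSet_singleton y)]
    by_cases hy : y = 0
    · simp [stepProb, hy]
    · have : (0 : stepGroup R) ≠ y := fun h => hy h.symm
      simp [stepProb, hy, this]
  | succ n ih =>
    have hstep : (Kernel.traj (X := fun _ => stepGroup R) (pastKernel T p ω) 0
        (fun _ => 0)).map (fun X => X (n + 1)) {y} = ∫⁻ x, transition T p ω x {y}
          ∂((Kernel.traj (X := fun _ => stepGroup R) (pastKernel T p ω) 0
            (fun _ => 0)).map (fun X => X n)) := by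
      rw [hpart (n + 1), hpart n, Kernel.partialTraj_succ_eq_comp (Nat.zero_le n),
        ← Kernel.map_apply _ (measurable_pi_apply _), Kernel.map_comp,
        Kernel.map_partialTraj_succ_self, Kernel.comp_apply' _ _ _ (measurableSet_singleton y),
        lintegral_map (Kernel.measurable_coe _ (measurableSet_singleton y))
          (measurable_pi_apply _)]
      rfl
    rw [hstep]
    have htrans : ∀ x, transition T p ω x {y}
        = ∑ z : R, Set.indicator {y - step z}
          (fun _ => ENNReal.ofReal (p (T (y - step z) ω) z)) x := by
      intro x
      simp only [transition, Kernel.ofFunOfCountable, Kernel.coe_mk, Measure.finsetSum_apply,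
        Measure.smul_apply, smul_eq_mul]
      refine Finset.sum_congr rfl fun z _ => ?_
      rw [Measure.dirac_apply' _ (measurableSet_singleton y)]
      by_cases hx : x = y - step z
      · subst hx
        simp
      · have : x + step z ≠ y := fun h => hx (eq_sub_of_add_eq h)
        simp [hx, this]
    simp only [htrans]
    rw [lintegral_finsetSum _ fun z _ => measurable_const.indicator (measurableSet_singleton _),
      h.stepProb_succ_last, ENNReal.ofReal_sum_of_nonneg fun z _ =>
        mul_nonneg (h.stepProb_nonneg _ _ _) (h.pos _ _).le]
    refine Finset.sum_congr rfl fun z _ => ?_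
    rw [lintegral_indicator_const (measurableSet_singleton _), ih,
      ENNReal.ofReal_mul (h.stepProb_nonneg _ _ _), mul_comm]

lemma quenched_apply_singleton (h : IsWalk T (fun ω (z : R) => p ω z)) (ω : Ω) (a : R → ℕ) :
    quenched T p ω {X | X (∑ z, a z) = ((endpoint step a : stepGroup R) : Fin d → ℤ)}
      = ENNReal.ofReal (Real.exp (-pathCost T step (fun ω (z : R) => p ω z) a ω)) := by
  have hm : Measurable fun (X : ℕ → stepGroup R) n => (X n : Fin d → ℤ) := by fun_prop
  have hs : MeasurableSet {X : ℕ → Fin d → ℤ |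
      X (∑ z, a z) = ((endpoint step a : stepGroup R) : Fin d → ℤ)} :=
    measurable_pi_apply (∑ z, a z) (measurableSet_singleton _)
  rw [h.exp_neg_pathCost, ← map_traj_singleton h, quenched, Measure.map_apply hm hs,
    Measure.map_apply (measurable_pi_apply _) (measurableSet_singleton _)]
  congr 1
  ext X
  simp

lemma measurableSet_hull (R : Finset (Fin d → ℤ)) : MeasurableSet (hull R) :=
  ((R.finite_toSet.image toE).isClosed_convexHull ℝ).measurableSet

lemma velocityLaw_apply (ω : Ω) (n : ℕ) {F : Set (hull R)} (hF : MeasurableSet F) :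
    velocityLaw T p ω n F = ((Kernel.traj (X := fun _ => stepGroup R) (pastKernel T p ω) 0
      (fun _ => 0)).map (fun X => X n))
        {x | (n : ℝ)⁻¹ • toE (x : Fin d → ℤ) ∈ Subtype.val '' F} := by
  have hF' : MeasurableSet (Subtype.val '' F : Set (EuclideanSpace ℝ (Fin d))) :=
    (MeasurableEmbedding.subtype_coe (measurableSet_hull R)).measurableSet_image.2 hF
  have hmeas : Measurable fun x : Fin d → ℤ => (n : ℝ)⁻¹ • toE x := measurable_of_countable _
  have hmeas' : Measurable fun X : ℕ → Fin d → ℤ => (n : ℝ)⁻¹ • toE (X n) :=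
    hmeas.comp (measurable_pi_apply n)
  have hm : Measurable fun (X : ℕ → stepGroup R) n => (X n : Fin d → ℤ) := by fun_prop
  rw [velocityLaw, (MeasurableEmbedding.subtype_coe (measurableSet_hull R)).comap_apply,
    Measure.map_apply hmeas' hF', quenched, Measure.map_apply hm (hmeas' hF'),
    Measure.map_apply (measurable_pi_apply _) (Set.to_countable _).measurableSet]
  rfl

end Lattice

/-! ### Typical environments have full measure -/

section Typical

variable {d : ℕ} {R : Finset (Fin d → ℤ)} {Ω : Type*} [MeasurableSpace Ω] {P : Measure Ω}
  {T : stepGroup R → Ω → Ω} {p : Ω → stdSimplex ℝ R}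

lemma isErgodicWalk (hT : IsErgodicSystem R P T) (hp : Measurable p) (hpos : ∀ ω z, 0 < p ω z)
    (hL : ClassL P T 1 (fun ω z => Real.log (p ω (z 0)))) :
    IsErgodicWalk P T step (fun ω (z : R) => p ω z) where
  map_zero ω := congrFun hT.map_zero ω
  map_add x y ω := congrFun (hT.map_add x y) ω
  pos := hpos
  sum_eq_one ω := (p ω).2.2
  closure_eq_top := closure_range_step
  measurePreserving := hT.measurePreserving
  zero_or_one := hT.zero_or_one
  measurable_prob z := (measurable_pi_apply z).comp (measurable_subtype_coe.comp hp)
  integrable_log z := memLp_one_iff_integrable.1 (hL fun _ => z).1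

lemma ae_hasSmallLineSums (hL : ClassL P T 1 (fun ω z => Real.log (p ω (z 0)))) :
    ∀ᵐ ω ∂P, HasSmallLineSums (fun x : stepGroup R => ‖toE (x : Fin d → ℤ)‖) T step
      (fun ω (z : R) => p ω z) ω := by
  have h1 : ∀ᵐ ω ∂P, ∀ w z : R, (z : Fin d → ℤ) ≠ 0 → limsup (fun ε : ℝ =>
        limsup (fun n : ℕ => ⨆ (x : stepGroup R) (_ : ‖toE (x : Fin d → ℤ)‖ ≤ (n : ℝ)),
            (∑ k ∈ Finset.range (⌊ε * n⌋₊ + 1),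
              ‖Real.log (p (T (x + k • step z) ω) w)‖ₑ) / (n : ENNReal))
          atTop) (𝓝[>] (0 : ℝ)) = 0 := by
    refine ae_all_iff.2 fun w => ae_all_iff.2 fun z => ?_
    by_cases hz : (z : Fin d → ℤ) = 0
    · exact ae_of_all _ fun ω h => absurd hz h
    · exact ((hL fun _ => w).2 z hz).mono fun ω hω _ => hω
  filter_upwards [h1] with ω hω κ hκ
  have h2 : ∀ᶠ ε : ℝ in 𝓝[>] 0, ∀ w z : R, (z : Fin d → ℤ) ≠ 0 →
      limsup (fun n : ℕ => ⨆ (x : stepGroup R) (_ : ‖toE (x : Fin d → ℤ)‖ ≤ (n : ℝ)),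
            (∑ k ∈ Finset.range (⌊ε * n⌋₊ + 1),
              ‖Real.log (p (T (x + k • step z) ω) w)‖ₑ) / (n : ENNReal))
          atTop < ENNReal.ofReal κ := by
    refine eventually_all.2 fun w => eventually_all.2 fun z => ?_
    by_cases hz : (z : Fin d → ℤ) = 0
    · exact Eventually.of_forall fun ε h => absurd hz h
    · refine (eventually_lt_of_limsup_lt ?_).mono fun ε hε _ => hε
      rw [hω w z hz]
      exact ENNReal.ofReal_pos.2 hκ
  obtain ⟨ε, hε, hε0⟩ := (h2.and self_mem_nhdsWithin).exists
  refine ⟨ε, hε0, ?_⟩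
  have h3 : ∀ᶠ n : ℕ in atTop, ∀ w z : R, (z : Fin d → ℤ) ≠ 0 →
      ⨆ (x : stepGroup R) (_ : ‖toE (x : Fin d → ℤ)‖ ≤ (n : ℝ)),
            (∑ k ∈ Finset.range (⌊ε * n⌋₊ + 1),
              ‖Real.log (p (T (x + k • step z) ω) w)‖ₑ) / (n : ENNReal)
          < ENNReal.ofReal κ := by
    refine eventually_all.2 fun w => eventually_all.2 fun z => ?_
    by_cases hz : (z : Fin d → ℤ) = 0
    · exact Eventually.of_forall fun ε h => absurd hz h
    · exact (eventually_lt_of_limsup_lt (hε w z hz)).mono fun n hn _ => hn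
  filter_upwards [h3, eventually_gt_atTop 0] with n hn hn0 x hx z hz w
  have hz' : (z : Fin d → ℤ) ≠ 0 := fun h => hz (Subtype.ext h)
  have h4 := ((le_iSup₂ (f := fun (x : stepGroup R) (_ : ‖toE (x : Fin d → ℤ)‖ ≤ (n : ℝ)) =>
    (∑ k ∈ Finset.range (⌊ε * n⌋₊ + 1),
      ‖Real.log (p (T (x + k • step z) ω) w)‖ₑ) / (n : ENNReal)) x hx).trans_lt (hn w z hz')).le
  simp only [Real.enorm_eq_ofReal_abs] at h4
  rw [← ENNReal.ofReal_sum_of_nonneg fun _ _ => abs_nonneg _, ← ENNReal.ofReal_natCast,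
    ← ENNReal.ofReal_div_of_pos (by exact_mod_cast hn0), ENNReal.ofReal_le_ofReal_iff hκ.le,
    div_le_iff₀ (by exact_mod_cast hn0)] at h4
  exact h4

/-- Almost every environment is typical.  If no step moves, then there is only one step, and no
path has any cost. -/
theorem ae_isTypical (hT : IsErgodicSystem R P T) (hp : Measurable p) (hpos : ∀ ω z, 0 < p ω z)
    (hL : ClassL P T 1 (fun ω z => Real.log (p ω (z 0)))) :
    ∀ᵐ ω ∂P, IsErgodicWalk.IsTypical P T step (fun ω (z : R) => p ω z) ω := by
  have hP := hT.isProbabilityMeasure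
  have h := isErgodicWalk hT hp hpos hL
  filter_upwards [h.ae_tendsto_pathCost, ae_hasSmallLineSums hL] with ω h1 h2
  refine ⟨?_, h1⟩
  by_cases hs : ∃ z : R, step z ≠ 0
  · obtain ⟨L, hL1, hL⟩ := exists_norm_endpoint_le R
    exact h.hasSmallDetours hL1 hL h2 hs
  · push Not at hs
    have hsub : ∀ z w : R, z = w := fun z w => Subtype.ext
      ((congrArg Subtype.val (hs z)).trans (congrArg Subtype.val (hs w)).symm)
    intro κ hκ
    refine ⟨1, one_pos, Eventually.of_forall fun n a k m _ _ _ => ?_⟩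
    refine (h.pathCost_le_of_steps_zero k (fun z _ => hs z) _).trans ?_
    have hlog : ∀ ω (z : R), Real.log (p ω z) = 0 := by
      intro ω z
      have h3 : ∑ w, p ω w = p ω z :=
        Finset.sum_eq_single z (fun w _ hw => absurd (hsub w z) hw)
          (fun hz => absurd (Finset.mem_univ z) hz)
      have h4 : ∑ w, p ω w = 1 := (p ω).2.2
      rw [← h3, h4, Real.log_one]
    simp only [hlog, abs_zero, mul_zero, Finset.sum_const_zero]
    positivity

end Typical

/-! ### The rate function on the convex hull of the steps -/

section RateFunction

variable {d : ℕ} {R : Finset (Fin d → ℤ)}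

/-- The mean displacement of a vector of step frequencies. -/
def meanStep (R : Finset (Fin d → ℤ)) (α : R → ℝ) : EuclideanSpace ℝ (Fin d) :=
  ∑ z : R, α z • toE (z : Fin d → ℤ)

lemma continuous_meanStep : Continuous (meanStep R) := by
  unfold meanStep; fun_prop

lemma meanStep_apply (α : R → ℝ) (i : Fin d) :
    meanStep R α i = ∑ z : R, α z * ((z : Fin d → ℤ) i : ℝ) := by
  simp [meanStep, toE_apply]

lemma meanStep_combo (a b : ℝ) (α β : R → ℝ) :
    meanStep R (a • α + b • β) = a • meanStep R α + b • meanStep R β := by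
  simp only [meanStep, Pi.add_apply, Pi.smul_apply, smul_eq_mul, add_smul, mul_smul,
    Finset.sum_add_distrib, Finset.smul_sum]

lemma meanStep_mem_hull {α : R → ℝ} (hα : α ∈ stdSimplex ℝ R) : meanStep R α ∈ hull R :=
  (convex_convexHull ℝ _).sum_mem (fun z _ => hα.1 z) hα.2
    fun z _ => subset_convexHull ℝ _ ⟨z, z.2, rfl⟩

lemma exists_meanStep_eq {ζ : EuclideanSpace ℝ (Fin d)} (hζ : ζ ∈ hull R) :
    ∃ α ∈ stdSimplex ℝ R, meanStep R α = ζ := by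
  classical
  have hconv : Convex ℝ (meanStep R '' stdSimplex ℝ R) := by
    rintro _ ⟨α, hα, rfl⟩ _ ⟨β, hβ, rfl⟩ a b ha hb hab
    exact ⟨a • α + b • β, convex_stdSimplex ℝ R hα hβ ha hb hab, meanStep_combo a b α β⟩
  refine convexHull_min ?_ hconv hζ
  rintro _ ⟨z, hz, rfl⟩
  refine ⟨Pi.single ⟨z, hz⟩ 1, single_mem_stdSimplex ℝ _, ?_⟩
  rw [meanStep, Finset.sum_eq_single ⟨z, hz⟩]
  · simp
  · intro w _ hw; simp [hw]
  · simp

lemma nonempty_of_mem_stdSimplex {α : R → ℝ} (hα : α ∈ stdSimplex ℝ R) : Nonempty R := by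
  by_contra h
  rw [not_nonempty_iff] at h
  have := hα.2
  simp at this

lemma exists_pos_mem_stdSimplex {α : R → ℝ} (hα : α ∈ stdSimplex ℝ R) :
    ∃ u ∈ stdSimplex ℝ R, ∀ z, 0 < u z := by
  have hne := nonempty_of_mem_stdSimplex hα
  have hN : (0 : ℝ) < Fintype.card R := by exact_mod_cast Fintype.card_pos
  refine ⟨fun _ => (Fintype.card R : ℝ)⁻¹, ⟨fun _ => (inv_pos.2 hN).le, ?_⟩,
    fun _ => inv_pos.2 hN⟩
  simp only [Finset.sum_const, Finset.card_univ, nsmul_eq_mul]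
  exact mul_inv_cancel₀ hN.ne'

/-- A point of the relative interior is the mean displacement of strictly positive frequencies: it
lies strictly between some point of the hull and the mean displacement of an arbitrary strictly
positive vector. -/
lemma exists_pos_meanStep_eq {ζ : EuclideanSpace ℝ (Fin d)}
    (hζ : ζ ∈ intrinsicInterior ℝ (hull R)) :
    ∃ β ∈ stdSimplex ℝ R, (∀ z, 0 < β z) ∧ meanStep R β = ζ := by
  have hζh : ζ ∈ hull R := intrinsicInterior_subset hζ
  obtain ⟨α, hα, hαζ⟩ := exists_meanStep_eq hζh
  obtain ⟨u, hu, hu0⟩ := exists_pos_mem_stdSimplex hα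
  set c := meanStep R u with hc
  have hch : c ∈ hull R := meanStep_mem_hull hu
  obtain ⟨y, hy, hyζ⟩ := mem_intrinsicInterior.1 hζ
  let γ : ℝ → affineSpan ℝ (hull R) := fun t =>
    ⟨AffineMap.lineMap ζ c (-t), AffineMap.lineMap_mem _ (subset_affineSpan ℝ _ hζh)
      (subset_affineSpan ℝ _ hch)⟩
  have hγ : Continuous γ := by
    refine Continuous.subtype_mk ?_ _
    exact AffineMap.lineMap_continuous.comp continuous_neg
  have hγ0 : γ 0 = y := Subtype.ext (by simp [γ, hyζ])
  have hev : ∀ᶠ t in 𝓝[>] (0 : ℝ), γ t ∈ interior ((↑) ⁻¹' hull R : Set (affineSpan ℝ (hull R))) :=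
    mem_nhdsWithin_of_mem_nhds (hγ.continuousAt.preimage_mem_nhds
      (by rw [hγ0]; exact isOpen_interior.mem_nhds hy))
  obtain ⟨t, ht, ht0⟩ := (hev.and self_mem_nhdsWithin).exists
  have ht0 : 0 < t := ht0
  have hth : γ t ∈ ((↑) ⁻¹' hull R : Set (affineSpan ℝ (hull R))) := interior_subset ht
  change AffineMap.lineMap ζ c (-t) ∈ hull R at hth
  obtain ⟨δ, hδ, hδe⟩ := exists_meanStep_eq hth
  have h1t : 0 < 1 + t := by linarith
  refine ⟨(1 + t)⁻¹ • δ + (t / (1 + t)) • u, ?_, fun z => ?_, ?_⟩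
  · refine convex_stdSimplex ℝ R hδ hu (by positivity) (by positivity) (by field_simp)
  · simp only [Pi.add_apply, Pi.smul_apply, smul_eq_mul]
    have h2 : 0 < t / (1 + t) * u z := mul_pos (by positivity) (hu0 z)
    have h3 : 0 ≤ (1 + t)⁻¹ * δ z := mul_nonneg (by positivity) (hδ.1 z)
    linarith
  · rw [meanStep_combo, hδe, ← hc, AffineMap.lineMap_apply]
    simp only [vsub_eq_sub, vadd_eq_add]
    have h4 : (1 + t)⁻¹ • (-t • (c - ζ) + ζ) + (t / (1 + t)) • c
        = ((1 + t)⁻¹ * (1 + t)) • ζ := by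
      rw [div_eq_mul_inv]
      module
    rw [h4, inv_mul_cancel₀ h1t.ne', one_smul]

variable {Ω : Type*} [MeasurableSpace Ω] {P : Measure Ω}
  {T : stepGroup R → Ω → Ω} {p : Ω → stdSimplex ℝ R}

/-- The rate function of the velocity: the limit rate of any frequencies with mean displacement
`ζ`. -/
def rateFunction (P : Measure Ω) (T : stepGroup R → Ω → Ω) (p : Ω → stdSimplex ℝ R)
    (ζ : EuclideanSpace ℝ (Fin d)) : ℝ :=
  limitRate P T step (fun ω (z : R) => p ω z)
    (Function.invFunOn (meanStep R) (stdSimplex ℝ R) ζ)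

lemma rateFunction_meanStep (h : IsErgodicWalk P T step (fun ω (z : R) => p ω z)) {α : R → ℝ}
    (hα : α ∈ stdSimplex ℝ R) :
    rateFunction P T p (meanStep R α) = limitRate P T step (fun ω (z : R) => p ω z) α := by
  have hex : ∃ β ∈ stdSimplex ℝ R, meanStep R β = meanStep R α := ⟨α, hα, rfl⟩
  have h1 := Function.invFunOn_mem hex
  have h2 := Function.invFunOn_eq hex
  -- the rows of the matrix are the coordinates of the steps, and a row of ones for the mass
  refine h.limitRate_congr (fun (z : R) (i : Option (Fin d)) => i.elim 1 (z : Fin d → ℤ)) ?_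
    h1.1 hα.1 (h1.2.trans hα.2.symm) ?_
  · intro a b hab
    constructor
    · have := hab none
      simp only [Option.elim_none, mul_one] at this
      exact_mod_cast this
    · refine Subtype.ext (funext fun i => ?_)
      have := hab (some i)
      simpa [coe_endpoint] using this
  · rintro (_ | i)
    · simpa using h1.2.trans hα.2.symm
    · have := congrArg (fun x : EuclideanSpace ℝ (Fin d) => x i) h2
      simpa [meanStep_apply] using this

lemma rateFunction_nonneg (h : IsErgodicWalk P T step (fun ω (z : R) => p ω z))
    {ζ : EuclideanSpace ℝ (Fin d)} (hζ : ζ ∈ hull R) : 0 ≤ rateFunction P T p ζ := by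
  obtain ⟨α, hα, rfl⟩ := exists_meanStep_eq hζ
  rw [rateFunction_meanStep h hα]
  exact h.limitRate_nonneg hα.1

/-- The rate function is continuous because the simplex of frequencies is compact, so that the hull
carries the quotient topology. -/
lemma continuousOn_rateFunction (h : IsErgodicWalk P T step (fun ω (z : R) => p ω z)) :
    ContinuousOn (rateFunction P T p) (hull R) := by
  rw [continuousOn_iff_continuous_domRestrict]
  let f : stdSimplex ℝ R → hull R := fun α => ⟨meanStep R α, meanStep_mem_hull α.2⟩
  have hf : Continuous f := (continuous_meanStep.comp continuous_subtype_val).subtype_mk _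
  have hsurj : Function.Surjective f := fun ζ => by
    obtain ⟨α, hα, hαζ⟩ := exists_meanStep_eq ζ.2
    exact ⟨⟨α, hα⟩, Subtype.ext hαζ⟩
  have : CompactSpace (stdSimplex ℝ R) := isCompact_iff_compactSpace.1 (isCompact_stdSimplex ℝ R)
  rw [(Topology.IsQuotientMap.of_surjective_continuous hsurj hf).continuous_iff]
  have h1 : (hull R).domRestrict (rateFunction P T p) ∘ f
      = (stdSimplex ℝ R).domRestrict (limitRate P T step (fun ω (z : R) => p ω z)) := by
    funext α
    exact rateFunction_meanStep h α.2
  rw [h1, ← continuousOn_iff_continuous_domRestrict]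
  exact h.continuousOn_limitRate.mono fun α hα => hα.1

lemma convexOn_rateFunction (h : IsErgodicWalk P T step (fun ω (z : R) => p ω z)) :
    ConvexOn ℝ (hull R) (rateFunction P T p) := by
  refine ⟨convex_convexHull ℝ _, ?_⟩
  intro x hx y hy a b ha hb hab
  obtain ⟨α, hα, rfl⟩ := exists_meanStep_eq hx
  obtain ⟨β, hβ, rfl⟩ := exists_meanStep_eq hy
  rcases ha.eq_or_lt with rfl | ha
  · simp [show b = 1 by linarith]
  rcases hb.eq_or_lt with rfl | hb
  · simp [show a = 1 by linarith]
  rw [← meanStep_combo, rateFunction_meanStep h hα, rateFunction_meanStep h hβ,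
    rateFunction_meanStep h (convex_stdSimplex ℝ R hα hβ ha.le hb.le hab), smul_eq_mul, smul_eq_mul,
    ← h.limitRate_smul ha, ← h.limitRate_smul hb]
  exact h.limitRate_add_le (fun z => mul_nonneg ha.le (hα.1 z))
    (fun z => mul_nonneg hb.le (hβ.1 z))

/-! ### Types with prescribed frequencies -/

lemma tendsto_type_div {a : ℕ → R → ℕ} {β : R → ℝ} {C : ℝ}
    (ha : ∀ n z, |(a n z : ℝ) - n * β z| ≤ C) :
    Tendsto (fun (n : ℕ) (z : R) => (a n z : ℝ) / n) atTop (𝓝 β) := by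
  refine tendsto_pi_nhds.2 fun z => ?_
  refine tendsto_iff_norm_sub_tendsto_zero.2 ?_
  refine squeeze_zero' (Eventually.of_forall fun n => norm_nonneg _) ?_
    (tendsto_const_div_atTop_nhds_zero_nat C)
  filter_upwards [eventually_gt_atTop 0] with n hn
  have hn' : (0 : ℝ) < n := by exact_mod_cast hn
  rw [Real.norm_eq_abs, le_div_iff₀ hn', ← abs_of_pos hn', ← abs_mul, abs_of_pos hn', sub_mul,
    div_mul_cancel₀ _ hn'.ne', mul_comm (β z)]
  exact ha n z

/-- In a typical environment, the costs of types with asymptotically positive frequencies grow at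
the limit rate of the frequencies. -/
lemma tendsto_pathCost_div (h : IsErgodicWalk P T step (fun ω (z : R) => p ω z)) {ω : Ω}
    (hω : IsErgodicWalk.IsTypical P T step (fun ω (z : R) => p ω z) ω) {a : ℕ → R → ℕ} {β : R → ℝ}
    {C : ℝ} (ha : ∀ n z, |(a n z : ℝ) - n * β z| ≤ C) (hβ : ∀ z, 0 < β z)
    (hsum : ∀ᶠ n in atTop, ∑ z, a n z = n) :
    Tendsto (fun n : ℕ => pathCost T step (fun ω (z : R) => p ω z) (a n) ω / n) atTop
      (𝓝 (limitRate P T step (fun ω (z : R) => p ω z) β)) := by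
  have hlim := tendsto_type_div ha
  have hlr : Tendsto (fun n : ℕ => limitRate P T step (fun ω (z : R) => p ω z)
      (fun z => (a n z : ℝ) / n)) atTop
      (𝓝 (limitRate P T step (fun ω (z : R) => p ω z) β)) :=
    (h.continuousOn_limitRate β fun z => (hβ z).le).tendsto.comp
      (tendsto_nhdsWithin_iff.2 ⟨hlim, Eventually.of_forall fun n z => by positivity⟩)
  obtain ⟨η, hη, hηβ⟩ : ∃ η : ℝ, 0 < η ∧ ∀ z, η < β z := by
    have : ∀ᶠ η : ℝ in 𝓝[>] 0, ∀ z, η < β z :=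
      eventually_all.2 fun z => mem_nhdsWithin_of_mem_nhds (gt_mem_nhds (hβ z))
    obtain ⟨η, h1, h2⟩ := (this.and self_mem_nhdsWithin).exists
    exact ⟨η, h2, h1⟩
  have hevη : ∀ᶠ n : ℕ in atTop, ∀ z, η * n ≤ a n z := by
    refine eventually_all.2 fun z => ?_
    filter_upwards [(tendsto_order.1 (tendsto_pi_nhds.1 hlim z)).1 η (hηβ z),
      eventually_gt_atTop 0] with n hn hn0
    have hn' : (0 : ℝ) < n := by exact_mod_cast hn0
    exact ((lt_div_iff₀ hn').1 hn).le
  refine tendsto_order.2 ⟨fun c hc => ?_, fun c hc => ?_⟩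
  · obtain ⟨c', h1, h2⟩ := exists_between hc
    filter_upwards [(tendsto_order.1 hlr).1 c' h2, h.eventually_le_pathCost hω (sub_pos.2 h1), hsum,
      eventually_gt_atTop 0] with n hn1 hn2 hn3 hn0
    have hn' : (0 : ℝ) < n := by exact_mod_cast hn0
    rw [lt_div_iff₀ hn']
    refine lt_of_lt_of_le ?_ (hn2 (a n) hn3)
    rw [mul_comm]
    gcongr
    linarith
  · obtain ⟨c', h1, h2⟩ := exists_between hc
    filter_upwards [(tendsto_order.1 hlr).2 c' h1, h.eventually_pathCost_le hω (sub_pos.2 h2) hη,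
      hsum, eventually_gt_atTop 0, hevη] with n hn1 hn2 hn3 hn0 hn4
    have hn' : (0 : ℝ) < n := by exact_mod_cast hn0
    rw [div_lt_iff₀ hn']
    refine lt_of_le_of_lt (hn2 (a n) hn3 hn4) ?_
    rw [mul_comm]
    gcongr
    linarith

lemma exists_types_near {β : R → ℝ} (hβ : β ∈ stdSimplex ℝ R) :
    ∃ C : ℝ, ∀ n : ℕ, ∃ a : R → ℕ, ∑ z, a z = n ∧ ∀ z, |(a z : ℝ) - n * β z| ≤ C := by
  classical
  obtain ⟨z₀⟩ := nonempty_of_mem_stdSimplex hβ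
  refine ⟨1 + Fintype.card R, fun n => ?_⟩
  have h0 : ∀ z, 0 ≤ (n : ℝ) * β z := fun z => mul_nonneg (Nat.cast_nonneg _) (hβ.1 z)
  have hs : ∑ z, (n : ℝ) * β z = n := by rw [← Finset.mul_sum, hβ.2, mul_one]
  have h1 : ∑ z, ⌊(n : ℝ) * β z⌋₊ ≤ n := by
    have : ∑ z, (⌊(n : ℝ) * β z⌋₊ : ℝ) ≤ n := by
      exact (Finset.sum_le_sum fun z _ => Nat.floor_le (h0 z)).trans_eq hs
    exact_mod_cast this
  have h2 : n ≤ ∑ z, ⌊(n : ℝ) * β z⌋₊ + Fintype.card R := by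
    have : (n : ℝ) ≤ ∑ z, (⌊(n : ℝ) * β z⌋₊ : ℝ) + Fintype.card R := by
      calc (n : ℝ) = ∑ z, (n : ℝ) * β z := hs.symm
        _ ≤ ∑ z, ((⌊(n : ℝ) * β z⌋₊ : ℝ) + 1) :=
            Finset.sum_le_sum fun z _ => (Nat.lt_floor_add_one _).le
        _ = _ := by simp [Finset.sum_add_distrib]
    exact_mod_cast this
  obtain ⟨r, hr⟩ := Nat.exists_eq_add_of_le h1
  refine ⟨(fun z => ⌊(n : ℝ) * β z⌋₊) + Pi.single z₀ r, ?_, fun z => ?_⟩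
  · simp only [Pi.add_apply, Finset.sum_add_distrib]
    rw [Finset.sum_pi_single']
    simp only [Finset.mem_univ, if_true]
    omega
  · have h3 : (Pi.single z₀ r : R → ℕ) z ≤ r := by
      by_cases hz : z = z₀
      · subst hz; simp
      · simp [hz]
    have h4 : ((Pi.single z₀ r : R → ℕ) z : ℝ) ≤ Fintype.card R := by
      have : (Pi.single z₀ r : R → ℕ) z ≤ Fintype.card R := by omega
      exact_mod_cast this
    have h5 := Nat.floor_le (h0 z)
    have h6 := Nat.lt_floor_add_one ((n : ℝ) * β z)
    have h7 : (0 : ℝ) ≤ ((Pi.single z₀ r : R → ℕ) z : ℝ) := Nat.cast_nonneg _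
    simp only [Pi.add_apply]
    push_cast
    rw [abs_le]
    constructor <;> linarith

/-- The admissible lattice points of a point of the relative interior are, for large times, the
endpoints of types with frequencies close to strictly positive ones. -/
lemma IsLatticeApprox.exists_types {ζ : EuclideanSpace ℝ (Fin d)} {xhat : ℕ → Fin d → ℤ}
    (hx : IsLatticeApprox R ζ xhat) {β' : R → ℝ} (hβ' : β' ∈ stdSimplex ℝ R)
    (hpos : ∀ z, 0 < β' z) (hζ : meanStep R β' = ζ) :
    ∃ (C : ℝ) (a : ℕ → R → ℕ), (∀ n z, |(a n z : ℝ) - n * β' z| ≤ C) ∧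
      ∀ᶠ n in atTop, ∑ z, a n z = n ∧ ((endpoint step (a n) : stepGroup R) : Fin d → ℤ) = xhat n := by
  obtain ⟨β, b, hβ0, hβ1, hβζ, -, hb01, -, hbsum, hxhat⟩ := hx
  obtain ⟨C, hC⟩ := exists_int_kernel_approx (v := fun z : R => β' z - β z)
    (fun (z : R) (i : Option (Fin d)) => i.elim 1 (z : Fin d → ℤ)) (by
      rintro (_ | i)
      · simp only [Option.elim_none, Int.cast_one, mul_one, Finset.sum_sub_distrib, hβ1]
        rw [hβ'.2, sub_self]
      · have h1 := congrArg (fun x : EuclideanSpace ℝ (Fin d) => x i) (hζ.trans hβζ.symm)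
        change meanStep R β' i = meanStep R β i at h1
        rw [meanStep_apply, meanStep_apply] at h1
        simp only [Option.elim_some, sub_mul, Finset.sum_sub_distrib, h1, sub_self])
  choose u hu huC using hC
  let k : ℕ → R → ℤ := fun n z => ⌊(n : ℝ) * β z⌋ + b n z + u n z
  have hk : ∀ n z, |(k n z : ℝ) - n * β' z| ≤ 1 + C := by
    intro n z
    have h1 := abs_le.1 (huC n z)
    have h2 := Int.floor_le ((n : ℝ) * β z)
    have h3 := Int.lt_floor_add_one ((n : ℝ) * β z)
    have h4 : (0 : ℝ) ≤ b n z ∧ (b n z : ℝ) ≤ 1 := by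
      rcases hb01 n z with h | h <;> simp [h]
    simp only [k]
    push_cast
    rw [abs_le]
    constructor <;> linarith
  refine ⟨1 + C, fun n z => (k n z).toNat, fun n z => ?_, ?_⟩
  · have h1 := abs_le.1 (hk n z)
    have h2 : (0 : ℝ) ≤ n * β' z := mul_nonneg (Nat.cast_nonneg _) (hpos z).le
    rcases le_total 0 (k n z) with h3 | h3
    · have : (((k n z).toNat : ℕ) : ℝ) = k n z := by exact_mod_cast Int.toNat_of_nonneg h3
      rw [this]; exact hk n z
    · have h4 : (k n z : ℝ) ≤ 0 := by exact_mod_cast h3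
      simp only [Int.toNat_of_nonpos h3, Nat.cast_zero]
      rw [abs_le]
      constructor <;> linarith
  · have hev : ∀ᶠ n : ℕ in atTop, ∀ z, 1 + C < n * β' z :=
      eventually_all.2 fun z =>
        (tendsto_natCast_atTop_atTop.atTop_mul_const (hpos z)).eventually_gt_atTop _
    filter_upwards [hev] with n hn
    have hk0 : ∀ z, ((k n z).toNat : ℤ) = k n z := fun z => Int.toNat_of_nonneg (by
      have h1 := (abs_le.1 (hk n z)).1
      have h2 : (0 : ℝ) ≤ k n z := by linarith [hn z]
      exact_mod_cast h2)
    constructor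
    · have h1 : ∑ z, k n z = n := by
        have h2 := hu n none
        simp only [Option.elim_none, mul_one] at h2
        simp only [k, Finset.sum_add_distrib, h2, hbsum]
        ring
      have h3 : ((∑ z, (k n z).toNat : ℕ) : ℤ) = n := by
        push_cast [hk0]
        exact h1
      exact_mod_cast h3
    · rw [coe_endpoint, hxhat]
      funext i
      have h2 := hu n (some i)
      simp only [Option.elim_some] at h2
      simp only [Finset.sum_apply, nsmul_eq_mul, zsmul_eq_mul, Pi.mul_apply,
        Pi.natCast_apply, Pi.intCast_apply, Int.cast_id]
      have h3 : ∀ z : R, ((k n z).toNat : ℤ) * (z : Fin d → ℤ) i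
          = (⌊(n : ℝ) * β z⌋ + b n z) * (z : Fin d → ℤ) i + u n z * (z : Fin d → ℤ) i := by
        intro z; rw [hk0]; simp only [k]; ring
      simp only [h3, Finset.sum_add_distrib, h2, add_zero]

end RateFunction

/-! ### The large deviation principle -/

section LDP

variable {d : ℕ} {R : Finset (Fin d → ℤ)} {Ω : Type*} {T : stepGroup R → Ω → Ω}
  {p : Ω → stdSimplex ℝ R}

/-- The types with `n` steps. -/
def typesOf (R : Finset (Fin d → ℤ)) (n : ℕ) : Finset (R → ℕ) :=
  (Fintype.piFinset fun _ => Finset.range (n + 1)).filter fun a => ∑ z, a z = n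

lemma mem_typesOf {n : ℕ} {a : R → ℕ} : a ∈ typesOf R n ↔ ∑ z, a z = n := by
  simp only [typesOf, Finset.mem_filter, Fintype.mem_piFinset, Finset.mem_range, and_iff_right_iff_imp]
  intro h z
  rw [Nat.lt_succ_iff, ← h]
  exact Finset.single_le_sum (fun _ _ => Nat.zero_le _) (Finset.mem_univ z)

lemma card_typesOf_le (n : ℕ) : (typesOf R n).card ≤ (n + 1) ^ Fintype.card R := by
  refine (Finset.card_filter_le _ _).trans ?_
  simp

lemma exists_type_of_stepProb_ne_zero (n : ℕ) (ω : Ω) (x : stepGroup R)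
    (hx : stepProb T step (fun ω (z : R) => p ω z) n ω x ≠ 0) :
    ∃ a : R → ℕ, ∑ z, a z = n ∧ endpoint step a = x := by
  classical
  induction n generalizing ω x with
  | zero =>
    have hx0 : x = 0 := by
      by_contra h
      simp [stepProb, h] at hx
    exact ⟨0, by simp, by simp [hx0]⟩
  | succ n ih =>
    rw [stepProb] at hx
    obtain ⟨z, _, hz⟩ := Finset.exists_ne_zero_of_sum_ne_zero hx
    obtain ⟨a, ha, hax⟩ := ih _ _ (right_ne_zero_of_mul hz)
    refine ⟨a + Pi.single z 1, ?_, ?_⟩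
    · simp only [Pi.add_apply, Finset.sum_add_distrib, ha]
      simp
    · rw [endpoint_add, hax, endpoint_single, one_smul, sub_add_cancel]

/-- The velocity law of a set is at most the sum of the probabilities of the endpoints of the types
with mean displacement in the set. -/
lemma velocityLaw_le_sum (h : IsWalk T (fun ω (z : R) => p ω z)) (ω : Ω) (n : ℕ)
    {F : Set (hull R)} (hF : MeasurableSet F) {D : ℝ}
    (hD : ∀ a : R → ℕ, ∑ z, a z = n →
      (n : ℝ)⁻¹ • toE ((endpoint step a : stepGroup R) : Fin d → ℤ) ∈ Subtype.val '' F →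
      D ≤ pathCost T step (fun ω (z : R) => p ω z) a ω) :
    velocityLaw T p ω n F ≤ ENNReal.ofReal ((n + 1) ^ Fintype.card R * Real.exp (-D)) := by
  classical
  rw [velocityLaw_apply ω n hF]
  set ν := (Kernel.traj (X := fun _ => stepGroup R) (pastKernel T p ω) 0
    (fun _ => 0)).map (fun X => X n) with hν
  set S : Set (stepGroup R) := {x | (n : ℝ)⁻¹ • toE (x : Fin d → ℤ) ∈ Subtype.val '' F} with hS
  let A : Finset (R → ℕ) := (typesOf R n).filter fun a => endpoint step a ∈ S
  let N : Set (stepGroup R) := {x | stepProb T step (fun ω (z : R) => p ω z) n ω x = 0}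
  have hN : ν N = 0 := by
    rw [← Set.biUnion_of_singleton N, measure_biUnion_null_iff (Set.to_countable N)]
    intro x hx
    rw [hν, map_traj_singleton h, show stepProb T step _ n ω x = 0 from hx, ENNReal.ofReal_zero]
  have hsub : S ⊆ (⋃ a ∈ A, {endpoint step a}) ∪ N := by
    intro x hx
    by_cases h0 : stepProb T step (fun ω (z : R) => p ω z) n ω x = 0
    · exact Or.inr h0
    · obtain ⟨a, ha, rfl⟩ := exists_type_of_stepProb_ne_zero n ω x h0
      left
      simp only [Set.mem_iUnion]
      exact ⟨a, Finset.mem_filter.2 ⟨mem_typesOf.2 ha, hx⟩, rfl⟩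
  calc ν S ≤ ν (⋃ a ∈ A, {endpoint step a}) + ν N := (measure_mono hsub).trans (measure_union_le _ _)
    _ = ν (⋃ a ∈ A, {endpoint step a}) := by rw [hN, add_zero]
    _ ≤ ∑ a ∈ A, ν {endpoint step a} := measure_biUnion_finset_le _ _
    _ ≤ ∑ _a ∈ A, ENNReal.ofReal (Real.exp (-D)) := by
        refine Finset.sum_le_sum fun a ha => ?_
        obtain ⟨ha1, ha2⟩ := Finset.mem_filter.1 ha
        have ha1 := mem_typesOf.1 ha1
        rw [hν, map_traj_singleton h]
        refine ENNReal.ofReal_le_ofReal ?_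
        rw [← ha1, ← h.exp_neg_pathCost]
        exact Real.exp_le_exp.2 (neg_le_neg (hD a ha1 ha2))
    _ ≤ ENNReal.ofReal ((n + 1) ^ Fintype.card R * Real.exp (-D)) := by
        rw [Finset.sum_const, nsmul_eq_mul, ENNReal.ofReal_mul (by positivity)]
        refine mul_le_mul_left ?_ _
        rw [← ENNReal.ofReal_natCast]
        refine ENNReal.ofReal_le_ofReal ?_
        have : A.card ≤ (n + 1) ^ Fintype.card R :=
          (Finset.card_filter_le _ _).trans (card_typesOf_le n)
        exact_mod_cast this

lemma le_velocityLaw (h : IsWalk T (fun ω (z : R) => p ω z)) (ω : Ω) (a : R → ℕ)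
    {O : Set (hull R)} (hO : MeasurableSet O)
    (ha : ((∑ z, a z : ℕ) : ℝ)⁻¹ • toE ((endpoint step a : stepGroup R) : Fin d → ℤ)
      ∈ Subtype.val '' O) :
    ENNReal.ofReal (Real.exp (-pathCost T step (fun ω (z : R) => p ω z) a ω))
      ≤ velocityLaw T p ω (∑ z, a z) O := by
  rw [velocityLaw_apply ω _ hO, h.exp_neg_pathCost, ← map_traj_singleton h]
  exact measure_mono (Set.singleton_subset_iff.2 ha)

lemma inv_smul_toE_endpoint (n : ℕ) (a : R → ℕ) :
    (n : ℝ)⁻¹ • toE ((endpoint step a : stepGroup R) : Fin d → ℤ)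
      = meanStep R (fun z => (a z : ℝ) / n) := by
  rw [toE_endpoint, meanStep, Finset.smul_sum]
  refine Finset.sum_congr rfl fun z _ => ?_
  rw [smul_smul, div_eq_inv_mul]

lemma type_div_mem_stdSimplex {n : ℕ} (hn : 0 < n) {a : R → ℕ} (ha : ∑ z, a z = n) :
    (fun z => (a z : ℝ) / n) ∈ stdSimplex ℝ R := by
  refine ⟨fun z => by positivity, ?_⟩
  have hn' : (n : ℝ) ≠ 0 := by exact_mod_cast hn.ne'
  have : ∑ z, (a z : ℝ) = n := by exact_mod_cast ha
  rw [← Finset.sum_div, this, div_self hn']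

lemma log_ofReal_exp_div (x : ℝ) (n : ℕ) :
    ENNReal.log (ENNReal.ofReal (Real.exp x)) / ((n : ℝ) : EReal) = ((x / n : ℝ) : EReal) := by
  rw [ENNReal.log_ofReal_of_pos (Real.exp_pos x), Real.log_exp, EReal.coe_div]

lemma eventually_pow_le_exp (r : ℕ) {κ : ℝ} (hκ : 0 < κ) :
    ∀ᶠ n : ℕ in atTop, ((n : ℝ) + 1) ^ r ≤ Real.exp (κ * n) := by
  have h1 := (isLittleO_pow_exp_pos_mul_atTop r hκ).def (Real.exp_pos (-κ))
  have h2 : Tendsto (fun n : ℕ => (n : ℝ) + 1) atTop atTop :=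
    tendsto_atTop_add_const_right _ _ tendsto_natCast_atTop_atTop
  filter_upwards [h2.eventually h1] with n hn
  rw [Real.norm_of_nonneg (by positivity), Real.norm_of_nonneg (Real.exp_pos _).le,
    ← Real.exp_add] at hn
  refine hn.trans (le_of_eq ?_)
  congr 1
  ring

variable [MeasurableSpace Ω] {P : Measure Ω}

lemma ldp_upper (h : IsErgodicWalk P T step (fun ω (z : R) => p ω z)) {ω : Ω}
    (hω : IsErgodicWalk.IsTypical P T step (fun ω (z : R) => p ω z) ω) {F : Set (hull R)}
    (hF : IsClosed F) :
    limsup (fun n : ℕ => ENNReal.log (velocityLaw T p ω n F) / ((n : ℝ) : EReal)) atTop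
      ≤ -(⨅ x ∈ F, ((rateFunction P T p (x : EuclideanSpace ℝ (Fin d)) : ℝ) : EReal)) := by
  refine EReal.le_of_forall_lt_iff_le.1 fun c hc => ?_
  obtain ⟨c', hc1, hc2⟩ := EReal.lt_iff_exists_real_btwn.1 (EReal.neg_lt_comm.1 hc)
  have hcc : 0 < (c + c') / 2 := by
    have : -c < c' := by exact_mod_cast hc1
    linarith
  refine limsup_le_of_le (by isBoundedDefault) ?_
  filter_upwards [h.eventually_le_pathCost hω hcc, eventually_pow_le_exp (Fintype.card R) hcc,
    eventually_gt_atTop 0] with n hn1 hn2 hn0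
  have hn' : (0 : ℝ) < n := by exact_mod_cast hn0
  have hle := velocityLaw_le_sum h.toIsWalk ω n hF.measurableSet
    (D := n * (c' - (c + c') / 2)) fun a ha haF => by
      refine le_trans ?_ (hn1 a ha)
      obtain ⟨ζ, hζ, hζe⟩ := haF
      rw [inv_smul_toE_endpoint] at hζe
      have h1 : (c' : EReal) < ((rateFunction P T p (ζ : EuclideanSpace ℝ (Fin d)) : ℝ) : EReal) :=
        hc2.trans_le (iInf₂_le ζ hζ)
      rw [hζe, rateFunction_meanStep h (type_div_mem_stdSimplex hn0 ha)] at h1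
      have h2 := EReal.coe_lt_coe_iff.1 h1
      gcongr
  have hle' : velocityLaw T p ω n F ≤ ENNReal.ofReal (Real.exp (n * c)) := by
    refine hle.trans (ENNReal.ofReal_le_ofReal ?_)
    calc ((n : ℝ) + 1) ^ Fintype.card R * Real.exp (-(n * (c' - (c + c') / 2)))
        ≤ Real.exp ((c + c') / 2 * n) * Real.exp (-(n * (c' - (c + c') / 2))) := by gcongr
      _ = Real.exp (n * c) := by rw [← Real.exp_add]; congr 1; ring
  refine (EReal.div_le_div_right_of_nonneg (by exact_mod_cast hn'.le)
    (ENNReal.log_monotone hle')).trans (le_of_eq ?_)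
  rw [log_ofReal_exp_div, mul_div_cancel_left₀ _ hn'.ne']

/-- A point of an open set is approximated by mean displacements of positive frequencies, at which
the lower bound is attained by a single endpoint. -/
lemma ldp_lower (h : IsErgodicWalk P T step (fun ω (z : R) => p ω z)) {ω : Ω}
    (hω : IsErgodicWalk.IsTypical P T step (fun ω (z : R) => p ω z) ω) {O : Set (hull R)}
    (hO : IsOpen O) :
    -(⨅ x ∈ O, ((rateFunction P T p (x : EuclideanSpace ℝ (Fin d)) : ℝ) : EReal))
      ≤ liminf (fun n : ℕ => ENNReal.log (velocityLaw T p ω n O) / ((n : ℝ) : EReal)) atTop := by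
  rw [EReal.neg_le]
  refine le_iInf₂ fun ζ hζ => ?_
  rw [EReal.neg_le]
  refine EReal.ge_of_forall_gt_iff_ge.1 fun c hc => ?_
  rw [← EReal.coe_neg, EReal.coe_lt_coe_iff] at hc
  obtain ⟨α, hα, hαζ⟩ := exists_meanStep_eq ζ.2
  obtain ⟨u, hu, hu0⟩ := exists_pos_mem_stdSimplex hα
  obtain ⟨V, hV, hVO⟩ := isOpen_induced_iff.1 hO
  have hmemO : ∀ x, x ∈ hull R → x ∈ V → x ∈ Subtype.val '' O := fun x hx hxV =>
    ⟨⟨x, hx⟩, by rw [← hVO]; exact hxV, rfl⟩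
  -- mix the frequencies `α` of `ζ` with a small portion of positive ones
  obtain ⟨β, hβ, hβ0, hβV, hβc⟩ : ∃ β ∈ stdSimplex ℝ R, (∀ z, 0 < β z) ∧ meanStep R β ∈ V ∧
      c < -limitRate P T step (fun ω (z : R) => p ω z) β := by
    let γ : ℝ → R → ℝ := fun t => (1 - t) • α + t • u
    have hγ : Continuous γ := by fun_prop
    have hγ0 : γ 0 = α := by simp [γ]
    have hγs : ∀ t, 0 < t → t < 1 → γ t ∈ stdSimplex ℝ R := fun t h0 h1 =>
      convex_stdSimplex ℝ R hα hu (by linarith) h0.le (by ring)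
    have hlt : ∀ᶠ t in 𝓝[>] (0 : ℝ), t < 1 := mem_nhdsWithin_of_mem_nhds (gt_mem_nhds one_pos)
    have h1 : ∀ᶠ t in 𝓝[>] (0 : ℝ), meanStep R (γ t) ∈ V := by
      refine mem_nhdsWithin_of_mem_nhds
        ((continuous_meanStep.comp hγ).continuousAt.preimage_mem_nhds (hV.mem_nhds ?_))
      rw [Function.comp, hγ0, hαζ]
      have : ζ ∈ Subtype.val ⁻¹' V := by rw [hVO]; exact hζ
      exact this
    have h2 : ∀ᶠ t in 𝓝[>] (0 : ℝ), c < -limitRate P T step (fun ω (z : R) => p ω z) (γ t) := by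
      have hcont := (h.continuousOn_limitRate α hα.1).neg
      have hγt : Tendsto γ (𝓝[>] 0) (𝓝[{α | ∀ z, 0 ≤ α z}] α) := by
        refine tendsto_nhdsWithin_iff.2 ⟨?_, ?_⟩
        · rw [← hγ0]; exact (hγ.tendsto 0).mono_left nhdsWithin_le_nhds
        · filter_upwards [hlt, self_mem_nhdsWithin] with t h1 h0
          exact (hγs t h0 h1).1
      refine (tendsto_order.1 (hcont.tendsto.comp hγt)).1 c ?_
      rw [Pi.neg_apply, ← rateFunction_meanStep h hα, hαζ]
      exact hc
    obtain ⟨t, ⟨⟨h1, h2⟩, h3⟩, h0⟩ := (((h1.and h2).and hlt).and self_mem_nhdsWithin).exists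
    have h0 : 0 < t := h0
    refine ⟨γ t, hγs t h0 h3, fun z => ?_, h1, h2⟩
    have h4 : 0 ≤ (1 - t) * α z := mul_nonneg (by linarith) (hα.1 z)
    have h5 : 0 < t * u z := mul_pos h0 (hu0 z)
    simp only [γ, Pi.add_apply, Pi.smul_apply, smul_eq_mul]
    linarith
  obtain ⟨C, hC⟩ := exists_types_near hβ
  choose a ha haC using hC
  have hlim := (tendsto_pathCost_div h hω haC hβ0 (Eventually.of_forall ha)).neg
  refine le_liminf_of_le (by isBoundedDefault) ?_
  have hVev := (continuous_meanStep.continuousAt.tendsto.comp (tendsto_type_div haC)).eventually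
    (hV.mem_nhds hβV)
  filter_upwards [(tendsto_order.1 hlim).1 c hβc, hVev, eventually_gt_atTop 0] with n hn1 hn2 hn0
  have hn' : (0 : ℝ) < n := by exact_mod_cast hn0
  have hle := le_velocityLaw h.toIsWalk ω (a n) hO.measurableSet (by
    rw [ha n, inv_smul_toE_endpoint]
    exact hmemO _ (meanStep_mem_hull (type_div_mem_stdSimplex hn0 (ha n))) hn2)
  rw [ha n] at hle
  refine le_trans ?_ (EReal.div_le_div_right_of_nonneg (by exact_mod_cast hn'.le)
    (ENNReal.log_monotone hle))
  rw [log_ofReal_exp_div, EReal.coe_le_coe_iff, neg_div]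
  exact hn1.le

theorem satisfiesLDP_velocityLaw (h : IsErgodicWalk P T step (fun ω (z : R) => p ω z)) {ω : Ω}
    (hω : IsErgodicWalk.IsTypical P T step (fun ω (z : R) => p ω z) ω) :
    SatisfiesLDP (velocityLaw T p ω) fun ζ : hull R => ((rateFunction P T p ζ : ℝ) : EReal) where
  nonneg ζ := EReal.coe_nonneg.2 (rateFunction_nonneg h ζ.2)
  lowerSemicontinuous := (continuous_coe_real_ereal.comp
    (continuousOn_iff_continuous_domRestrict.1 (continuousOn_rateFunction h))).lowerSemicontinuous
  upper _ hF := ldp_upper h hω hF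
  lower _ hO := ldp_lower h hω hO

theorem tendsto_log_quenched (h : IsErgodicWalk P T step (fun ω (z : R) => p ω z)) {ω : Ω}
    (hω : IsErgodicWalk.IsTypical P T step (fun ω (z : R) => p ω z) ω)
    {ζ : EuclideanSpace ℝ (Fin d)} (hζ : ζ ∈ intrinsicInterior ℝ (hull R))
    {xhat : ℕ → Fin d → ℤ} (hx : IsLatticeApprox R ζ xhat) :
    Tendsto (fun n : ℕ => ENNReal.log (quenched T p ω {X | X n = xhat n}) / ((n : ℝ) : EReal))
      atTop (𝓝 (-((rateFunction P T p ζ : ℝ) : EReal))) := by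
  obtain ⟨β, hβ, hβ0, rfl⟩ := exists_pos_meanStep_eq hζ
  obtain ⟨C, a, haC, ha⟩ := hx.exists_types hβ hβ0 rfl
  have hlim := (tendsto_pathCost_div h hω haC hβ0 (ha.mono fun n hn => hn.1)).neg
  rw [rateFunction_meanStep h hβ, ← EReal.coe_neg]
  refine ((continuous_coe_real_ereal.tendsto _).comp hlim).congr' ?_
  filter_upwards [ha] with n ⟨h1, h2⟩
  have h3 := quenched_apply_singleton h.toIsWalk ω (a n)
  rw [h1, h2] at h3
  rw [h3, log_ofReal_exp_div, Function.comp, neg_div]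

end LDP

/-! ### Removal of exceptional environments -/

section Exceptional

variable {d : ℕ} {R : Finset (Fin d → ℤ)} {Ω : Type*} {T : stepGroup R → Ω → Ω}
  {p p' : Ω → stdSimplex ℝ R}

lemma transition_congr {ω : Ω} (h : ∀ x, p' (T x ω) = p (T x ω)) :
    transition T p' ω = transition T p ω := by
  ext x : 1
  simp only [transition, Kernel.ofFunOfCountable, Kernel.coe_mk, h]

lemma quenched_congr {ω : Ω} (h : ∀ x, p' (T x ω) = p (T x ω)) :
    quenched T p' ω = quenched T p ω := by
  have h1 : pastKernel T p' ω = pastKernel T p ω := by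
    funext n
    rw [pastKernel, pastKernel, transition_congr h]
  simp only [quenched, h1]

lemma velocityLaw_congr {ω : Ω} (h : ∀ x, p' (T x ω) = p (T x ω)) :
    velocityLaw T p' ω = velocityLaw T p ω := by
  funext n
  rw [velocityLaw, velocityLaw, quenched_congr h]

lemma ClassL.congr [MeasurableSpace Ω] {P : Measure Ω} {ℓ : ℕ} {g g' : Ω → (Fin ℓ → R) → ℝ} (hg : ClassL P T ℓ g)
    (h0 : ∀ᵐ ω ∂P, g ω = g' ω) (h : ∀ᵐ ω ∂P, ∀ x, g (T x ω) = g' (T x ω)) :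
    ClassL P T ℓ g' := by
  intro zt
  refine ⟨(hg zt).1.ae_eq (h0.mono fun ω hω => congrFun hω zt), fun z hz => ?_⟩
  filter_upwards [(hg zt).2 z hz, h] with ω h1 h2
  simpa only [h2] using h1

end Exceptional

end RWRE

end

theorem mainTheorem8 {d : ℕ} (hd : 1 ≤ d) (R : Finset (Fin d → ℤ))
    {Ω : Type*} [MeasurableSpace Ω] (P : Measure Ω)
    (T : RWRE.stepGroup R → Ω → Ω) (hT : RWRE.IsErgodicSystem R P T)
    (p : Ω → stdSimplex ℝ R) (hp : Measurable p)
    (hpos : ∀ᵐ ω ∂P, ∀ z : R, 0 < p ω z)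
    (hL : RWRE.ClassL P T 1 (fun ω z => Real.log (p ω (z 0)))) :
    ∃ I : EuclideanSpace ℝ (Fin d) → ℝ,
      (∀ ζ ∈ RWRE.hull R, 0 ≤ I ζ) ∧
      ContinuousOn I (RWRE.hull R) ∧
      ConvexOn ℝ (RWRE.hull R) I ∧
      (∀ᵐ ω ∂P, RWRE.SatisfiesLDP (RWRE.velocityLaw T p ω)
        (fun ζ : RWRE.hull R => ((I ζ : ℝ) : EReal))) ∧
      (∀ᵐ ω ∂P, ∀ ζ ∈ intrinsicInterior ℝ (RWRE.hull R),
        ∀ xhat : ℕ → (Fin d → ℤ), RWRE.IsLatticeApprox R ζ xhat →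
          Tendsto
            (fun n : ℕ =>
              ENNReal.log (RWRE.quenched T p ω {X | X n = xhat n}) / ((n : ℝ) : EReal))
            atTop (𝓝 (-((I ζ : ℝ) : EReal)))) := by
  classical
  have hP := hT.isProbabilityMeasure
  obtain ⟨ω₀, hω₀⟩ := hpos.exists
  -- on the null set where some step probability vanishes, use those of a fixed environment
  let p' : Ω → stdSimplex ℝ R := fun ω => if ∀ z : R, 0 < p ω z then p ω else p ω₀
  have hset : MeasurableSet {ω | ∀ z : R, 0 < p ω z} := by
    rw [Set.ofPred_forall]
    exact MeasurableSet.iInter fun z => measurableSet_lt measurable_const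
      ((measurable_pi_apply z).comp (measurable_subtype_coe.comp hp))
  have hp' : Measurable p' := Measurable.ite hset hp measurable_const
  have hpos' : ∀ ω (z : R), 0 < p' ω z := by
    intro ω z
    by_cases h : ∀ z : R, 0 < p ω z
    · simp only [p', if_pos h]; exact h z
    · simp only [p', if_neg h]; exact hω₀ z
  have heq : ∀ᵐ ω ∂P, p' ω = p ω := hpos.mono fun ω h => if_pos h
  have horb : ∀ᵐ ω ∂P, ∀ x, p' (T x ω) = p (T x ω) :=
    ae_all_iff.2 fun x => (hT.measurePreserving x).quasiMeasurePreserving.ae heq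
  have hL' : RWRE.ClassL P T 1 (fun ω z => Real.log (p' ω (z 0))) :=
    hL.congr (heq.mono fun ω h => by simp only [h]) (horb.mono fun ω h x => by simp only [h x])
  have hW := RWRE.isErgodicWalk hT hp' hpos' hL'
  have htyp := RWRE.ae_isTypical hT hp' hpos' hL'
  refine ⟨RWRE.rateFunction P T p', fun ζ hζ => RWRE.rateFunction_nonneg hW hζ,
    RWRE.continuousOn_rateFunction hW, RWRE.convexOn_rateFunction hW, ?_, ?_⟩
  · filter_upwards [htyp, horb] with ω h1 h2
    rw [← RWRE.velocityLaw_congr h2]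
    exact RWRE.satisfiesLDP_velocityLaw hW h1
  · filter_upwards [htyp, horb] with ω h1 h2 ζ hζ xhat hx
    rw [← RWRE.quenched_congr h2]
    exact RWRE.tendsto_log_quenched hW h1 hζ hx
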